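/- Let $\Bbbk$ be a field of characteristic $0$. For a quiver $Q$ with a finite set $I$ of vertices (and an arbitrary set of arrows), let $A=\Bbbk Q$ be its path algebra: the paths, including the trivial path $e_i$ at each vertex $i$, form a basis, and the product $pq$ of two paths is their concatenation (first $p$, then $q$) if $q$ starts where $p$ ends, and $0$ otherwise. Let $R=\bigoplus_{i\in I}\Bbbk e_i\subset A$. Let $\Omega^1_RA$ be the kernel of the multiplication map $A\otimes_RA\to A$, and let $\Omega_RA=T_A(\Omega^1_RA)$ be the graded algebra of noncommutative differential forms relative to $R$, with the differential $d$: the graded derivation of degree one such that $da=1\otimes a-a\otimes 1$ and $d(u\,dv)=du\,dv$ for $a,u,v\in A$. Let $\mathrm{DR}_RA=\Omega_RA/[\Omega_RA,\Omega_RA]$ be the quotient by the linear span of all super-commutators $uv-(-1)^{pq}vu$, $u\in\Omega^p_RA$, $v\in\Omega^q_RA$, with the induced grading and differential, and let $(\mathrm{DR}^2_RA)_{\mathrm{closed}}=\ker(d:\mathrm{DR}^2_RA\to\mathrm{DR}^3_RA)$. Let $[A,A]$ be the linear span of all commutators $ab-ba$ in $A$ and let $[A,A]^R$ be the space of those elements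 of $[A,A]$ that commute with every element of $R$. Then there are isomorphisms of vector spaces, one for each quiver $Q$ with finitely many vertices, $$\Phi_Q:\ (\mathrm{DR}^2_RA)_{\mathrm{closed}}\ \xrightarrow{\ \sim\ }\ [A,A]^R ,$$ which are given on the classes of the closed forms $da\,db$, $a,b\in A$, by $$\Phi_Q(da\,db)=\sum_{i\in I}e_i\,(ab-ba)\,e_i ,$$ and which are natural: if $Q'$ is another such quiver, with path algebra $A'$ and vertex subalgebra $R'$, and if $f:A\to A'$ is a homomorphism of unital $\Bbbk$-algebras with $f(R)=R'$, then $\Phi_{Q'}\circ f_*=f\circ\Phi_Q$, where $f_*:(\mathrm{DR}^2_RA)_{\mathrm{closed}}\to(\mathrm{DR}^2_{R'}A')_{\mathrm{closed}}$ is the map induced by $f$. -/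

import Mathlib

open scoped TensorProduct

universe w u v

noncomputable section

/-! ## Noncommutative differential forms relative to a subalgebra -/

namespace NCForms

section Forms

variable {k : Type w} [Field k] {B : Type u} [Ring B] [Algebra k B]

/-- The relations `b r ⊗ c = b ⊗ r c`, for `r ∈ R`, inside `B ⊗[k] B`. -/
def balancing (R : Subalgebra k B) : Submodule k (B ⊗[k] B) :=
  Submodule.span k {x | ∃ b : B, ∃ r ∈ R, ∃ c : B, x = (b * r) ⊗ₜ[k] c - b ⊗ₜ[k] (r * c)}

/-- The tensor product `B ⊗_R B` over a (possibly noncentral) subalgebra `R` of `B`. -/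
abbrev RelTensor (R : Subalgebra k B) : Type u := (B ⊗[k] B) ⧸ balancing R

/-- The element `b ⊗ c` of `B ⊗_R B`. -/
def rtmul (R : Subalgebra k B) (b c : B) : RelTensor R := (balancing R).mkQ (b ⊗ₜ[k] c)

theorem rtmul_balanced {R : Subalgebra k B} (b : B) {r : B} (hr : r ∈ R) (c : B) :
    rtmul R (b * r) c = rtmul R b (r * c) := by
  rw [← sub_eq_zero]
  simp only [rtmul, ← map_sub]
  exact (Submodule.Quotient.mk_eq_zero _).2 (Submodule.subset_span ⟨b, r, hr, c, rfl⟩)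

/-- A linear map out of `B ⊗_R B` from a balanced linear map out of `B ⊗[k] B`. -/
def rlift (R : Subalgebra k B) {M : Type*} [AddCommGroup M] [Module k M] (g : B ⊗[k] B →ₗ[k] M)
    (hg : ∀ b : B, ∀ r ∈ R, ∀ c : B, g ((b * r) ⊗ₜ[k] c) = g (b ⊗ₜ[k] (r * c))) :
    RelTensor R →ₗ[k] M :=
  (balancing R).liftQ g (by
    refine Submodule.span_le.2 ?_
    rintro _ ⟨b, r, hr, c, rfl⟩
    simp [hg b r hr c])

@[simp] theorem rlift_rtmul (R : Subalgebra k B) {M : Type*} [AddCommGroup M] [Module k M]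
    (g : B ⊗[k] B →ₗ[k] M)
    (hg : ∀ b : B, ∀ r ∈ R, ∀ c : B, g ((b * r) ⊗ₜ[k] c) = g (b ⊗ₜ[k] (r * c))) (b c : B) :
    rlift R g hg (rtmul R b c) = g (b ⊗ₜ[k] c) := rfl

theorem rext {R : Subalgebra k B} {M : Type*} [AddCommGroup M] [Module k M]
    {f g : RelTensor R →ₗ[k] M} (h : ∀ b c, f (rtmul R b c) = g (rtmul R b c)) : f = g := by
  apply Submodule.linearMap_qext
  exact TensorProduct.ext' h

/-- The multiplication map `B ⊗_R B → B`. -/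
def mulMap (R : Subalgebra k B) : RelTensor R →ₗ[k] B :=
  rlift R (LinearMap.mul' k B) (by intros; simp [mul_assoc])

/-- Left multiplication by `b` on `B ⊗_R B`. -/
def leftMul (R : Subalgebra k B) (b : B) : RelTensor R →ₗ[k] RelTensor R :=
  rlift R ((balancing R).mkQ ∘ₗ TensorProduct.map (LinearMap.mulLeft k b) LinearMap.id) (by
    intro x r hr y
    simpa [rtmul, mul_assoc] using rtmul_balanced (R := R) (b * x) hr y)

/-- Right multiplication by `b` on `B ⊗_R B`. -/
def rightMul (R : Subalgebra k B) (b : B) : RelTensor R →ₗ[k] RelTensor R :=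
  rlift R ((balancing R).mkQ ∘ₗ TensorProduct.map LinearMap.id (LinearMap.mulRight k b)) (by
    intro x r hr y
    simpa [rtmul, mul_assoc] using rtmul_balanced (R := R) x hr (y * b))

@[simp] theorem mulMap_rtmul (R : Subalgebra k B) (b c : B) :
    mulMap R (rtmul R b c) = b * c := rfl

@[simp] theorem leftMul_rtmul (R : Subalgebra k B) (a b c : B) :
    leftMul R a (rtmul R b c) = rtmul R (a * b) c := rfl

@[simp] theorem rightMul_rtmul (R : Subalgebra k B) (a b c : B) :
    rightMul R a (rtmul R b c) = rtmul R b (c * a) := rfl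

theorem mulMap_leftMul (R : Subalgebra k B) (a : B) (x : RelTensor R) :
    mulMap R (leftMul R a x) = a * mulMap R x := by
  have : mulMap R ∘ₗ leftMul R a = LinearMap.mulLeft k a ∘ₗ mulMap R :=
    rext (by intros; simp [mul_assoc])
  exact LinearMap.congr_fun this x

theorem mulMap_rightMul (R : Subalgebra k B) (a : B) (x : RelTensor R) :
    mulMap R (rightMul R a x) = mulMap R x * a := by
  have : mulMap R ∘ₗ rightMul R a = LinearMap.mulRight k a ∘ₗ mulMap R :=
    rext (by intros; simp [mul_assoc])
  exact LinearMap.congr_fun this x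

/-- The space `Ω¹_R B` of relative noncommutative 1-forms: the kernel of `B ⊗_R B → B`. -/
abbrev OneForms (R : Subalgebra k B) : Submodule k (RelTensor R) := LinearMap.ker (mulMap R)

/-- The left action of `b ∈ B` on `Ω¹_R B`. -/
def lact (R : Subalgebra k B) (b : B) : OneForms R →ₗ[k] OneForms R :=
  (leftMul R b).restrict (by
    intro x hx
    simp only [LinearMap.mem_ker] at hx ⊢
    simp [mulMap_leftMul, hx])

/-- The right action of `b ∈ B` on `Ω¹_R B`. -/
def ract (R : Subalgebra k B) (b : B) : OneForms R →ₗ[k] OneForms R :=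
  (rightMul R b).restrict (by
    intro x hx
    simp only [LinearMap.mem_ker] at hx ⊢
    simp [mulMap_rightMul, hx])

/-- The universal derivation `d b = 1 ⊗ b - b ⊗ 1`, from `B` to `Ω¹_R B`. -/
def univDer (R : Subalgebra k B) : B →ₗ[k] OneForms R :=
  LinearMap.codRestrict (OneForms R)
    ((balancing R).mkQ ∘ₗ ((TensorProduct.mk k B B 1) - (TensorProduct.mk k B B).flip 1)) (by
      intro b
      change mulMap R (rtmul R 1 b - rtmul R b 1) = 0
      simp)

theorem univDer_coe (R : Subalgebra k B) (b : B) :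
    (univDer R b : RelTensor R) = rtmul R 1 b - rtmul R b 1 := rfl

/-- The relations which make the tensor algebra over `k` of `B × Ω¹_R B` into the tensor algebra
over `B` of the bimodule `Ω¹_R B`. -/
inductive FormRel (R : Subalgebra k B) :
    TensorAlgebra k (B × OneForms R) → TensorAlgebra k (B × OneForms R) → Prop
  | one : FormRel R (TensorAlgebra.ι k ((1 : B), (0 : OneForms R))) 1
  | mul (b c : B) : FormRel R
      (TensorAlgebra.ι k (b, (0 : OneForms R)) * TensorAlgebra.ι k (c, (0 : OneForms R)))
      (TensorAlgebra.ι k (b * c, (0 : OneForms R)))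
  | left (b : B) (ω : OneForms R) : FormRel R
      (TensorAlgebra.ι k (b, (0 : OneForms R)) * TensorAlgebra.ι k ((0 : B), ω))
      (TensorAlgebra.ι k ((0 : B), lact R b ω))
  | right (ω : OneForms R) (b : B) : FormRel R
      (TensorAlgebra.ι k ((0 : B), ω) * TensorAlgebra.ι k (b, (0 : OneForms R)))
      (TensorAlgebra.ι k ((0 : B), ract R b ω))

/-- The algebra `Ω_R B = T_B(Ω¹_R B)` of noncommutative differential forms on `B` relative
to `R`. -/
def Forms (R : Subalgebra k B) : Type (max w u) := RingQuot (FormRel R)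

instance (R : Subalgebra k B) : Ring (Forms R) := inferInstanceAs (Ring (RingQuot (FormRel R)))

instance (R : Subalgebra k B) : Algebra k (Forms R) :=
  inferInstanceAs (Algebra k (RingQuot (FormRel R)))

/-- The projection from the tensor algebra. -/
def Forms.proj (R : Subalgebra k B) : TensorAlgebra k (B × OneForms R) →ₐ[k] Forms R :=
  RingQuot.mkAlgHom k (FormRel R)

theorem Forms.proj_surjective (R : Subalgebra k B) : Function.Surjective (Forms.proj R) :=
  RingQuot.mkAlgHom_surjective k (FormRel R)

theorem Forms.proj_rel {R : Subalgebra k B} {x y : TensorAlgebra k (B × OneForms R)}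
    (h : FormRel R x y) : Forms.proj R x = Forms.proj R y :=
  RingQuot.mkAlgHom_rel k h

/-- The inclusion of `B` as the forms of degree zero. -/
def Forms.base (R : Subalgebra k B) : B →ₐ[k] Forms R :=
  AlgHom.ofLinearMap
    ((Forms.proj R).toLinearMap ∘ₗ TensorAlgebra.ι k ∘ₗ LinearMap.inl k B (OneForms R))
    (by simpa using Forms.proj_rel (FormRel.one (R := R)))
    (by
      intro b c
      simpa using (Forms.proj_rel (FormRel.mul (R := R) b c)).symm)

/-- The inclusion of the 1-forms `Ω¹_R B`. -/
def Forms.one (R : Subalgebra k B) : OneForms R →ₗ[k] Forms R :=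
  (Forms.proj R).toLinearMap ∘ₗ TensorAlgebra.ι k ∘ₗ LinearMap.inr k B (OneForms R)

theorem Forms.base_mul_one (R : Subalgebra k B) (b : B) (ω : OneForms R) :
    Forms.base R b * Forms.one R ω = Forms.one R (lact R b ω) := by
  simpa [Forms.base, Forms.one] using Forms.proj_rel (FormRel.left (R := R) b ω)

theorem Forms.one_mul_base (R : Subalgebra k B) (ω : OneForms R) (b : B) :
    Forms.one R ω * Forms.base R b = Forms.one R (ract R b ω) := by
  simpa [Forms.base, Forms.one] using Forms.proj_rel (FormRel.right (R := R) ω b)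

theorem Forms.proj_ι (R : Subalgebra k B) (x : B × OneForms R) :
    Forms.proj R (TensorAlgebra.ι k x) = Forms.base R x.1 + Forms.one R x.2 := by
  change _ = Forms.proj R (TensorAlgebra.ι k (x.1, 0)) + Forms.proj R (TensorAlgebra.ι k (0, x.2))
  rw [← map_add, ← map_add]
  simp

/-- The universal property of the tensor algebra of the bimodule `Ω¹_R B`. -/
def Forms.lift (R : Subalgebra k B) {C : Type*} [Ring C] [Algebra k C] (f : B →ₐ[k] C)
    (g : OneForms R →ₗ[k] C) (hl : ∀ b ω, g (lact R b ω) = f b * g ω)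
    (hr : ∀ b ω, g (ract R b ω) = g ω * f b) : Forms R →ₐ[k] C :=
  RingQuot.liftAlgHom k ⟨TensorAlgebra.lift k (f.toLinearMap.coprod g), by
    intro x y h
    cases h with
    | one => simp
    | mul b c => simp
    | left b ω => simp [hl]
    | right ω b => simp [hr]⟩

theorem Forms.lift_proj (R : Subalgebra k B) {C : Type*} [Ring C] [Algebra k C] (f : B →ₐ[k] C)
    (g : OneForms R →ₗ[k] C) (hl : ∀ b ω, g (lact R b ω) = f b * g ω)
    (hr : ∀ b ω, g (ract R b ω) = g ω * f b) (x : TensorAlgebra k (B × OneForms R)) :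
    Forms.lift R f g hl hr (Forms.proj R x) = TensorAlgebra.lift k (f.toLinearMap.coprod g) x :=
  RingQuot.liftAlgHom_mkAlgHom_apply k _ _ _

@[simp] theorem Forms.lift_base (R : Subalgebra k B) {C : Type*} [Ring C] [Algebra k C]
    (f : B →ₐ[k] C)
    (g : OneForms R →ₗ[k] C) (hl : ∀ b ω, g (lact R b ω) = f b * g ω)
    (hr : ∀ b ω, g (ract R b ω) = g ω * f b) (b : B) :
    Forms.lift R f g hl hr (Forms.base R b) = f b := by
  change Forms.lift R f g hl hr (Forms.proj R (TensorAlgebra.ι k (b, 0))) = _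
  rw [Forms.lift_proj]
  simp

@[simp] theorem Forms.lift_one (R : Subalgebra k B) {C : Type*} [Ring C] [Algebra k C]
    (f : B →ₐ[k] C)
    (g : OneForms R →ₗ[k] C) (hl : ∀ b ω, g (lact R b ω) = f b * g ω)
    (hr : ∀ b ω, g (ract R b ω) = g ω * f b) (ω : OneForms R) :
    Forms.lift R f g hl hr (Forms.one R ω) = g ω := by
  change Forms.lift R f g hl hr (Forms.proj R (TensorAlgebra.ι k (0, ω))) = _
  rw [Forms.lift_proj]
  simp

theorem Forms.hom_ext {R : Subalgebra k B} {C : Type*} [Ring C] [Algebra k C]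
    {f g : Forms R →ₐ[k] C} (hb : ∀ b, f (Forms.base R b) = g (Forms.base R b))
    (ho : ∀ ω, f (Forms.one R ω) = g (Forms.one R ω)) : f = g := by
  apply AlgHom.ext
  intro x
  obtain ⟨x, rfl⟩ := Forms.proj_surjective R x
  have : f.comp (Forms.proj R) = g.comp (Forms.proj R) := by
    apply TensorAlgebra.hom_ext
    apply LinearMap.ext
    intro y
    simp [Forms.proj_ι, hb, ho]
  exact AlgHom.congr_fun this x

theorem Forms.induction {R : Subalgebra k B} {P : Forms R → Prop}
    (hb : ∀ b, P (Forms.base R b)) (ho : ∀ ω, P (Forms.one R ω))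
    (hadd : ∀ x y, P x → P y → P (x + y)) (hmul : ∀ x y, P x → P y → P (x * y))
    (x : Forms R) : P x := by
  obtain ⟨x, rfl⟩ := Forms.proj_surjective R x
  induction x using TensorAlgebra.induction with
  | algebraMap r =>
    have h := hb (algebraMap k B r)
    rw [AlgHom.commutes] at h
    rwa [AlgHom.commutes]
  | ι x => rw [Forms.proj_ι]; exact hadd _ _ (hb _) (ho _)
  | mul x y hx hy => rw [map_mul]; exact hmul _ _ hx hy
  | add x y hx hy => rw [map_add]; exact hadd _ _ hx hy

/-- The component `Ωⁿ_R B = B · (Ω¹_R B) ⋯ (Ω¹_R B)` of forms of degree `n`. -/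
def Forms.deg (R : Subalgebra k B) (n : ℕ) : Submodule k (Forms R) :=
  LinearMap.range (Forms.base R).toLinearMap * LinearMap.range (Forms.one R) ^ n

/-- The map `∑ b ⊗ c ↦ ∑ db · dc` from `B ⊗_R B` to 2-forms; on `Ω¹_R B` it sends `u dv`
to `du dv`. -/
def dTwo (R : Subalgebra k B) : RelTensor R →ₗ[k] Forms R :=
  rlift R (LinearMap.mul' k (Forms R) ∘ₗ
    TensorProduct.map (Forms.one R ∘ₗ univDer R) (Forms.one R ∘ₗ univDer R)) (by
      intro b r hr c
      have h1 : univDer R (b * r) = ract R r (univDer R b) := by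
        apply Subtype.ext
        change rtmul R 1 (b * r) - rtmul R (b * r) 1 =
          rightMul R r (rtmul R 1 b - rtmul R b 1)
        rw [rtmul_balanced b hr 1]
        simp
      have h2 : univDer R (r * c) = lact R r (univDer R c) := by
        apply Subtype.ext
        change rtmul R 1 (r * c) - rtmul R (r * c) 1 =
          leftMul R r (rtmul R 1 c - rtmul R c 1)
        rw [← rtmul_balanced 1 hr c]
        simp
      simp only [LinearMap.comp_apply, TensorProduct.map_tmul, LinearMap.mul'_apply, h1, h2]
      rw [← Forms.one_mul_base, ← Forms.base_mul_one, mul_assoc])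

@[simp] theorem dTwo_rtmul (R : Subalgebra k B) (b c : B) :
    dTwo R (rtmul R b c) = Forms.one R (univDer R b) * Forms.one R (univDer R c) := rfl

theorem univDer_mul (R : Subalgebra k B) (b c : B) :
    univDer R (b * c) = lact R b (univDer R c) + ract R c (univDer R b) := by
  apply Subtype.ext
  change rtmul R 1 (b * c) - rtmul R (b * c) 1 =
    leftMul R b (rtmul R 1 c - rtmul R c 1) + rightMul R c (rtmul R 1 b - rtmul R b 1)
  simp

theorem dTwo_leftMul (R : Subalgebra k B) (b : B) (ω : OneForms R) :
    dTwo R (leftMul R b ω) =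
      Forms.base R b * dTwo R ω + Forms.one R (univDer R b) * Forms.one R ω := by
  let F : RelTensor R →ₗ[k] OneForms R := LinearMap.codRestrict (OneForms R)
    (LinearMap.id - rlift R ((balancing R).mkQ ∘ₗ (TensorProduct.mk k B B).flip 1 ∘ₗ
      LinearMap.mul' k B) (by intros; simp [mul_assoc])) (by
      intro x
      have : mulMap R ∘ₗ (LinearMap.id - rlift R ((balancing R).mkQ ∘ₗ
        (TensorProduct.mk k B B).flip 1 ∘ₗ
        LinearMap.mul' k B) (by intros; simp [mul_assoc])) = 0 := by
        apply rext
        intro b c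
        change mulMap R (rtmul R b c - rtmul R (b * c) 1) = 0
        simp
      exact LinearMap.congr_fun this x)
  have hF : F ω = ω := by
    apply Subtype.ext
    have : (rlift R ((balancing R).mkQ ∘ₗ (TensorProduct.mk k B B).flip 1 ∘ₗ
      LinearMap.mul' k B) (by intros; simp [mul_assoc])) =
      (balancing R).mkQ ∘ₗ (TensorProduct.mk k B B).flip 1 ∘ₗ mulMap R := by
      apply rext; intro b c; rfl
    change (ω : RelTensor R) - _ = _
    rw [this]
    have h0 : mulMap R ω = 0 := ω.2
    simp [h0]
  have key : dTwo R ∘ₗ leftMul R b = LinearMap.mulLeft k (Forms.base R b) ∘ₗ dTwo R +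
      LinearMap.mulLeft k (Forms.one R (univDer R b)) ∘ₗ Forms.one R ∘ₗ F := by
    apply rext
    intro x y
    have hFxy : F (rtmul R x y) = lact R x (univDer R y) := by
      apply Subtype.ext
      change rtmul R x y - rtmul R (x * y) 1 = leftMul R x (rtmul R 1 y - rtmul R y 1)
      simp
    simp only [LinearMap.comp_apply, LinearMap.add_apply, leftMul_rtmul, dTwo_rtmul,
      LinearMap.mulLeft_apply, hFxy, univDer_mul, map_add, ← Forms.base_mul_one,
      ← Forms.one_mul_base]
    noncomm_ring
  have := LinearMap.congr_fun key ω
  simpa [hF] using this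

theorem dTwo_rightMul (R : Subalgebra k B) (b : B) (ω : OneForms R) :
    dTwo R (rightMul R b ω) =
      dTwo R ω * Forms.base R b - Forms.one R ω * Forms.one R (univDer R b) := by
  let F : RelTensor R →ₗ[k] OneForms R := LinearMap.codRestrict (OneForms R)
    (LinearMap.id - rlift R ((balancing R).mkQ ∘ₗ (TensorProduct.mk k B B) 1 ∘ₗ
      LinearMap.mul' k B) (by intros; simp [mul_assoc])) (by
      intro x
      have : mulMap R ∘ₗ (LinearMap.id - rlift R ((balancing R).mkQ ∘ₗ
        (TensorProduct.mk k B B) 1 ∘ₗ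
        LinearMap.mul' k B) (by intros; simp [mul_assoc])) = 0 := by
        apply rext
        intro b c
        change mulMap R (rtmul R b c - rtmul R 1 (b * c)) = 0
        simp
      exact LinearMap.congr_fun this x)
  have hF : F ω = ω := by
    apply Subtype.ext
    have : (rlift R ((balancing R).mkQ ∘ₗ (TensorProduct.mk k B B) 1 ∘ₗ
      LinearMap.mul' k B) (by intros; simp [mul_assoc])) =
      (balancing R).mkQ ∘ₗ (TensorProduct.mk k B B) 1 ∘ₗ mulMap R := by
      apply rext; intro b c; rfl
    change (ω : RelTensor R) - _ = _
    rw [this]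
    have h0 : mulMap R ω = 0 := ω.2
    simp [h0]
  have key : dTwo R ∘ₗ rightMul R b = LinearMap.mulRight k (Forms.base R b) ∘ₗ dTwo R -
      LinearMap.mulRight k (Forms.one R (univDer R b)) ∘ₗ Forms.one R ∘ₗ F := by
    apply rext
    intro x y
    have hFxy : F (rtmul R x y) = - ract R y (univDer R x) := by
      apply Subtype.ext
      change rtmul R x y - rtmul R 1 (x * y) = - rightMul R y (rtmul R 1 x - rtmul R x 1)
      simp
    simp only [LinearMap.comp_apply, LinearMap.sub_apply, rightMul_rtmul, dTwo_rtmul,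
      LinearMap.mulRight_apply, hFxy, univDer_mul, map_add, map_neg, ← Forms.base_mul_one,
      ← Forms.one_mul_base]
    noncomm_ring
  have := LinearMap.congr_fun key ω
  simpa [hF] using this

/-- The upper triangular matrix `[[x, y], [0, z]]`, linearly in the entries. -/
def upper {M C : Type*} [AddCommGroup M] [Module k M] [Ring C] [Algebra k C]
    (f g h : M →ₗ[k] C) : M →ₗ[k] Matrix (Fin 2) (Fin 2) C where
  toFun m := !![f m, g m; 0, h m]
  map_add' x y := by
    ext i j
    fin_cases i <;> fin_cases j <;> simp
  map_smul' r x := by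
    ext i j
    fin_cases i <;> fin_cases j <;> simp

theorem upper_apply {M C : Type*} [AddCommGroup M] [Module k M] [Ring C] [Algebra k C]
    (f g h : M →ₗ[k] C) (m : M) : upper f g h m = !![f m, g m; 0, h m] := rfl

theorem univDer_one (R : Subalgebra k B) : univDer R 1 = 0 := by
  apply Subtype.ext
  change rtmul R (1 : B) 1 - rtmul R (1 : B) 1 = 0
  exact sub_self _

/-- The degree zero part of `diffHom`. -/
def diffBase (R : Subalgebra k B) : B →ₐ[k] Matrix (Fin 2) (Fin 2) (Forms R) :=
  AlgHom.ofLinearMap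
    (upper (Forms.base R).toLinearMap (Forms.one R ∘ₗ univDer R) (Forms.base R).toLinearMap)
    (by
      simp only [upper_apply, LinearMap.comp_apply, univDer_one, AlgHom.toLinearMap_apply,
        map_one, map_zero]
      exact Matrix.one_fin_two.symm)
    (by
      intro b c
      simp only [upper_apply, LinearMap.comp_apply, univDer_mul, AlgHom.toLinearMap_apply,
        map_mul, map_add, Matrix.mul_fin_two, ← Forms.base_mul_one, ← Forms.one_mul_base,
        mul_zero, zero_mul, add_zero, zero_add])

theorem diffBase_apply (R : Subalgebra k B) (b : B) : diffBase R b =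
    !![Forms.base R b, Forms.one R (univDer R b); 0, Forms.base R b] := rfl

/-- The degree one part of `diffHom`. -/
def diffOne (R : Subalgebra k B) : OneForms R →ₗ[k] Matrix (Fin 2) (Fin 2) (Forms R) :=
  upper (-Forms.one R) (dTwo R ∘ₗ (OneForms R).subtype) (Forms.one R)

theorem diffOne_apply (R : Subalgebra k B) (ω : OneForms R) : diffOne R ω =
    !![-Forms.one R ω, dTwo R ω; 0, Forms.one R ω] := rfl

/-- The algebra map `x ↦ [[(-1)^{deg x} x, dx], [0, x]]` which encodes the degree one graded
derivation `d` of `Ω_R B` with `d b = 1 ⊗ b - b ⊗ 1` and `d (u dv) = du dv`. -/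
def Forms.diffHom (R : Subalgebra k B) : Forms R →ₐ[k] Matrix (Fin 2) (Fin 2) (Forms R) :=
  Forms.lift R (diffBase R) (diffOne R)
    (by
      intro b ω
      have h : dTwo R (lact R b ω : RelTensor R) = _ := dTwo_leftMul R b ω
      simp only [diffBase_apply, diffOne_apply, h, Matrix.mul_fin_two, ← Forms.base_mul_one,
        mul_zero, zero_mul, add_zero, zero_add, mul_neg, neg_zero])
    (by
      intro b ω
      have h : dTwo R (ract R b ω : RelTensor R) = _ := dTwo_rightMul R b ω
      simp only [diffBase_apply, diffOne_apply, h, Matrix.mul_fin_two, ← Forms.one_mul_base,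
        mul_zero, zero_mul, add_zero, zero_add, neg_mul]
      rw [neg_add_eq_sub])

@[simp] theorem Forms.diffHom_base (R : Subalgebra k B) (b : B) :
    Forms.diffHom R (Forms.base R b) =
      !![Forms.base R b, Forms.one R (univDer R b); 0, Forms.base R b] :=
  Forms.lift_base R _ _ _ _ b

@[simp] theorem Forms.diffHom_one (R : Subalgebra k B) (ω : OneForms R) :
    Forms.diffHom R (Forms.one R ω) = !![-Forms.one R ω, dTwo R ω; 0, Forms.one R ω] :=
  Forms.lift_one R _ _ _ _ ω

/-- The de Rham differential `d` of `Ω_R B`. -/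
def Forms.d (R : Subalgebra k B) : Forms R →ₗ[k] Forms R where
  toFun x := Forms.diffHom R x 0 1
  map_add' x y := by rw [map_add]; rfl
  map_smul' r x := by rw [map_smul]; rfl

/-- The automorphism `x ↦ (-1)^{deg x} x` of the space of forms. -/
def Forms.sgn (R : Subalgebra k B) : Forms R →ₗ[k] Forms R where
  toFun x := Forms.diffHom R x 0 0
  map_add' x y := by rw [map_add]; rfl
  map_smul' r x := by rw [map_smul]; rfl

theorem Forms.diffHom_eq (R : Subalgebra k B) (x : Forms R) :
    Forms.diffHom R x = !![Forms.sgn R x, Forms.d R x; 0, x] := by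
  have h : Forms.diffHom R x 1 0 = 0 ∧ Forms.diffHom R x 1 1 = x := by
    induction x using Forms.induction with
    | hb b => simp
    | ho ω => simp
    | hadd x y hx hy => simp [hx, hy]
    | hmul x y hx hy => simp [Matrix.mul_apply, hx, hy]
  ext i j
  fin_cases i <;> fin_cases j
  · rfl
  · rfl
  · exact h.1
  · exact h.2

theorem Forms.d_base (R : Subalgebra k B) (b : B) :
    Forms.d R (Forms.base R b) = Forms.one R (univDer R b) := by
  simp [Forms.d]

theorem Forms.d_one (R : Subalgebra k B) (ω : OneForms R) :
    Forms.d R (Forms.one R ω) = dTwo R ω := by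
  simp [Forms.d]

theorem Forms.sgn_mul (R : Subalgebra k B) (x y : Forms R) :
    Forms.sgn R (x * y) = Forms.sgn R x * Forms.sgn R y := by
  change Forms.diffHom R (x * y) 0 0 = _
  rw [map_mul, Forms.diffHom_eq, Forms.diffHom_eq]
  simp

theorem Forms.d_mul' (R : Subalgebra k B) (x y : Forms R) :
    Forms.d R (x * y) = Forms.d R x * y + Forms.sgn R x * Forms.d R y := by
  change Forms.diffHom R (x * y) 0 1 = _
  rw [map_mul, Forms.diffHom_eq, Forms.diffHom_eq]
  simp [add_comm]

theorem Forms.base_mem_deg (R : Subalgebra k B) (b : B) : Forms.base R b ∈ Forms.deg R 0 := by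
  simp [Forms.deg]

theorem Forms.one_mem_deg (R : Subalgebra k B) (ω : OneForms R) :
    Forms.one R ω ∈ Forms.deg R 1 := by
  have h := Submodule.mul_mem_mul (M := LinearMap.range (Forms.base R).toLinearMap)
    (N := LinearMap.range (Forms.one R) ^ 1) (m := 1) (n := Forms.one R ω)
    ⟨1, by simp⟩ (by simp)
  rw [one_mul] at h
  exact h

theorem Forms.range_one_mul_range_base (R : Subalgebra k B) :
    LinearMap.range (Forms.one R) * LinearMap.range (Forms.base R).toLinearMap ≤
      LinearMap.range (Forms.base R).toLinearMap * LinearMap.range (Forms.one R) := by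
  refine Submodule.mul_le.2 ?_
  rintro _ ⟨ω, rfl⟩ _ ⟨b, rfl⟩
  have h := Submodule.mul_mem_mul (M := LinearMap.range (Forms.base R).toLinearMap)
    (N := LinearMap.range (Forms.one R)) (m := 1) (n := Forms.one R (ract R b ω))
    ⟨1, by simp⟩ ⟨_, rfl⟩
  simpa [Forms.one_mul_base] using h

theorem Forms.range_base_mul_self (R : Subalgebra k B) :
    LinearMap.range (Forms.base R).toLinearMap * LinearMap.range (Forms.base R).toLinearMap ≤
      LinearMap.range (Forms.base R).toLinearMap := by
  refine Submodule.mul_le.2 ?_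
  rintro _ ⟨b, rfl⟩ _ ⟨c, rfl⟩
  exact ⟨b * c, by simp⟩

theorem Forms.pow_mul_range_base (R : Subalgebra k B) (n : ℕ) :
    LinearMap.range (Forms.one R) ^ n * LinearMap.range (Forms.base R).toLinearMap ≤
      LinearMap.range (Forms.base R).toLinearMap * LinearMap.range (Forms.one R) ^ n := by
  induction n with
  | zero => simp
  | succ n ih =>
    calc LinearMap.range (Forms.one R) ^ (n + 1) * LinearMap.range (Forms.base R).toLinearMap
        = LinearMap.range (Forms.one R) ^ n *
          (LinearMap.range (Forms.one R) * LinearMap.range (Forms.base R).toLinearMap) := by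
          rw [pow_succ, mul_assoc]
      _ ≤ LinearMap.range (Forms.one R) ^ n *
          (LinearMap.range (Forms.base R).toLinearMap * LinearMap.range (Forms.one R)) :=
          mul_le_mul' le_rfl (Forms.range_one_mul_range_base R)
      _ = (LinearMap.range (Forms.one R) ^ n * LinearMap.range (Forms.base R).toLinearMap) *
          LinearMap.range (Forms.one R) := by rw [mul_assoc]
      _ ≤ (LinearMap.range (Forms.base R).toLinearMap * LinearMap.range (Forms.one R) ^ n) *
          LinearMap.range (Forms.one R) := mul_le_mul' ih le_rfl
      _ = _ := by rw [mul_assoc, ← pow_succ]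

theorem Forms.deg_mul_le (R : Subalgebra k B) (p q : ℕ) :
    Forms.deg R p * Forms.deg R q ≤ Forms.deg R (p + q) := by
  unfold Forms.deg
  calc _ = LinearMap.range (Forms.base R).toLinearMap * (LinearMap.range (Forms.one R) ^ p *
        LinearMap.range (Forms.base R).toLinearMap) * LinearMap.range (Forms.one R) ^ q := by
        simp only [mul_assoc]
    _ ≤ LinearMap.range (Forms.base R).toLinearMap *
        (LinearMap.range (Forms.base R).toLinearMap * LinearMap.range (Forms.one R) ^ p) *
        LinearMap.range (Forms.one R) ^ q :=
        mul_le_mul' (mul_le_mul' le_rfl (Forms.pow_mul_range_base R p)) le_rfl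
    _ = (LinearMap.range (Forms.base R).toLinearMap *
        LinearMap.range (Forms.base R).toLinearMap) *
        (LinearMap.range (Forms.one R) ^ p * LinearMap.range (Forms.one R) ^ q) := by
        simp only [mul_assoc]
    _ ≤ LinearMap.range (Forms.base R).toLinearMap *
        (LinearMap.range (Forms.one R) ^ p * LinearMap.range (Forms.one R) ^ q) :=
        mul_le_mul' (Forms.range_base_mul_self R) le_rfl
    _ = _ := by rw [pow_add]

theorem Forms.mul_mem_deg {R : Subalgebra k B} {p q : ℕ} {x y : Forms R}
    (hx : x ∈ Forms.deg R p) (hy : y ∈ Forms.deg R q) : x * y ∈ Forms.deg R (p + q) :=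
  Forms.deg_mul_le R p q (Submodule.mul_mem_mul hx hy)

/-- Induction for homogeneous forms. -/
theorem Forms.deg_induction {R : Subalgebra k B} {P : ℕ → Forms R → Prop}
    (hadd : ∀ n x y, P n x → P n y → P n (x + y))
    (hb : ∀ b, P 0 (Forms.base R b))
    (ho : ∀ n x ω, x ∈ Forms.deg R n → P n x → P (n + 1) (x * Forms.one R ω))
    {n : ℕ} {x : Forms R} (hx : x ∈ Forms.deg R n) : P n x := by
  induction n generalizing x with
  | zero =>
    obtain ⟨b, rfl⟩ : x ∈ LinearMap.range (Forms.base R).toLinearMap := by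
      simpa [Forms.deg] using hx
    exact hb b
  | succ n ih =>
    have hx' : x ∈ Forms.deg R n * LinearMap.range (Forms.one R) := by
      rw [Forms.deg, pow_succ, ← mul_assoc] at hx
      exact hx
    refine Submodule.mul_induction_on hx' ?_ (fun y z => hadd _ y z)
    rintro y hy _ ⟨ω, rfl⟩
    exact ho n y ω hy (ih hy)

theorem Forms.sgn_of_mem {R : Subalgebra k B} {n : ℕ} {x : Forms R} (hx : x ∈ Forms.deg R n) :
    Forms.sgn R x = (-1 : k) ^ n • x := by
  refine Forms.deg_induction (P := fun n x => Forms.sgn R x = (-1 : k) ^ n • x)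
    (by intro n x y hx hy; simp [hx, hy]) ?_ ?_ hx
  · intro b; simp [Forms.sgn]
  · intro n x ω _ hx
    have h : Forms.sgn R (Forms.one R ω) = - Forms.one R ω := by simp [Forms.sgn]
    rw [Forms.sgn_mul, hx, h, pow_succ]
    simp

theorem Forms.d_mul {R : Subalgebra k B} {n : ℕ} {x : Forms R} (hx : x ∈ Forms.deg R n)
    (y : Forms R) : Forms.d R (x * y) = Forms.d R x * y + (-1 : k) ^ n • (x * Forms.d R y) := by
  rw [Forms.d_mul', Forms.sgn_of_mem hx, smul_mul_assoc]

theorem Forms.dTwo_mem_deg (R : Subalgebra k B) (x : RelTensor R) :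
    dTwo R x ∈ Forms.deg R 2 := by
  obtain ⟨x, rfl⟩ := Submodule.mkQ_surjective (balancing R) x
  induction x using TensorProduct.induction_on with
  | zero => rw [map_zero, map_zero]; exact zero_mem _
  | tmul b c =>
    have h := Forms.mul_mem_deg (Forms.one_mem_deg R (univDer R b))
      (Forms.one_mem_deg R (univDer R c))
    exact h
  | add x y hx hy =>
    rw [map_add, map_add]
    exact add_mem hx hy

theorem Forms.d_mem_deg {R : Subalgebra k B} {n : ℕ} {x : Forms R} (hx : x ∈ Forms.deg R n) :
    Forms.d R x ∈ Forms.deg R (n + 1) := by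
  refine Forms.deg_induction (P := fun n x => Forms.d R x ∈ Forms.deg R (n + 1))
    (by intro n x y hx hy; rw [map_add]; exact add_mem hx hy) ?_ ?_ hx
  · intro b
    rw [Forms.d_base]
    exact Forms.one_mem_deg R _
  · intro n x ω hx hdx
    rw [Forms.d_mul hx, Forms.d_one]
    exact add_mem (Forms.mul_mem_deg hdx (Forms.one_mem_deg R ω))
      (Submodule.smul_mem _ _ (Forms.mul_mem_deg (q := 2) hx (Forms.dTwo_mem_deg R _)))

/-! ## The relative de Rham complex -/

/-- The super-commutator space `[Ω, Ω]` of the graded algebra `Ω = Ω_R B`. -/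
def superComm (R : Subalgebra k B) : Submodule k (Forms R) :=
  Submodule.span k {x | ∃ p q : ℕ, ∃ u ∈ Forms.deg R p, ∃ v ∈ Forms.deg R q,
    x = u * v - (-1 : k) ^ (p * q) • (v * u)}

/-- The noncommutative de Rham complex `DR_R B = Ω_R B / [Ω_R B, Ω_R B]`. -/
abbrev DR (R : Subalgebra k B) : Type _ := Forms R ⧸ superComm R

theorem superComm_le_comap_d (R : Subalgebra k B) :
    superComm R ≤ (superComm R).comap (Forms.d R) := by
  refine Submodule.span_le.2 ?_
  rintro _ ⟨p, q, u, hu, v, hv, rfl⟩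
  have h1 : Forms.d R u * v - (-1 : k) ^ ((p + 1) * q) • (v * Forms.d R u) ∈ superComm R :=
    Submodule.subset_span ⟨_, _, _, Forms.d_mem_deg hu, _, hv, rfl⟩
  have h2 : u * Forms.d R v - (-1 : k) ^ (p * (q + 1)) • (Forms.d R v * u) ∈ superComm R :=
    Submodule.subset_span ⟨_, _, _, hu, _, Forms.d_mem_deg hv, rfl⟩
  have h := add_mem h1 (Submodule.smul_mem _ ((-1 : k) ^ p) h2)
  rw [SetLike.mem_coe, Submodule.mem_comap]
  convert h using 1
  rw [map_sub, map_smul, Forms.d_mul hu, Forms.d_mul hv]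
  have e1 : (-1 : k) ^ p * (-1) ^ (p * (q + 1)) = (-1) ^ (p * q) := by
    have : (-1 : k) ^ p * (-1) ^ p = 1 := by rw [← mul_pow]; simp
    rw [mul_add, pow_add, mul_one, mul_comm ((-1 : k) ^ (p * q)), ← mul_assoc, this, one_mul]
  have e2 : (-1 : k) ^ ((p + 1) * q) = (-1) ^ (p * q) * (-1) ^ q := by
    rw [add_mul, pow_add, one_mul]
  simp only [smul_sub, smul_add, smul_smul, e1, e2]
  abel

/-- The de Rham differential on `DR_R B`. -/
def DR.d (R : Subalgebra k B) : DR R →ₗ[k] DR R :=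
  (superComm R).mapQ (superComm R) (Forms.d R) (superComm_le_comap_d R)

/-- The class in `DR_R B` of a form. -/
def DR.mk (R : Subalgebra k B) : Forms R →ₗ[k] DR R := (superComm R).mkQ

/-- The component `DRⁿ_R B`. -/
def DR.deg (R : Subalgebra k B) (n : ℕ) : Submodule k (DR R) := (Forms.deg R n).map (DR.mk R)

/-- The space `(DRⁿ_R B)_closed`, the kernel of `d : DRⁿ_R B → DRⁿ⁺¹_R B`. -/
def DR.closed (R : Subalgebra k B) (n : ℕ) : Submodule k (DR R) :=
  DR.deg R n ⊓ LinearMap.ker (DR.d R)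

theorem DR.d_mk (R : Subalgebra k B) (x : Forms R) :
    DR.d R (DR.mk R x) = DR.mk R (Forms.d R x) := rfl

theorem DR.d_mem_deg (R : Subalgebra k B) {n : ℕ} {x : DR R} (hx : x ∈ DR.deg R n) :
    DR.d R x ∈ DR.deg R (n + 1) := by
  obtain ⟨x, hx, rfl⟩ := hx
  exact ⟨_, Forms.d_mem_deg hx, rfl⟩

theorem Forms.sgn_sgn (R : Subalgebra k B) (x : Forms R) :
    Forms.sgn R (Forms.sgn R x) = x := by
  induction x using Forms.induction with
  | hb b => simp [Forms.sgn]
  | ho ω => simp [Forms.sgn]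
  | hadd x y hx hy => rw [map_add, map_add, hx, hy]
  | hmul x y hx hy => rw [Forms.sgn_mul, Forms.sgn_mul, hx, hy]

theorem Forms.d_d (R : Subalgebra k B) (x : Forms R) : Forms.d R (Forms.d R x) = 0 := by
  have hdb : ∀ b, Forms.d R (Forms.one R (univDer R b)) = 0 := by
    intro b
    rw [Forms.d_one]
    change dTwo R (rtmul R 1 b - rtmul R b 1) = 0
    simp [univDer_one]
  have hdd : ∀ x : RelTensor R, Forms.d R (dTwo R x) = 0 := by
    intro x
    have : Forms.d R ∘ₗ dTwo R = 0 := by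
      apply rext
      intro b c
      simp [Forms.d_mul (Forms.one_mem_deg R _), hdb]
    exact LinearMap.congr_fun this x
  have hs : ∀ x, Forms.d R (Forms.sgn R x) = - Forms.sgn R (Forms.d R x) ∧
      Forms.d R (Forms.d R x) = 0 := by
    intro x
    induction x using Forms.induction with
    | hb b =>
      rw [Forms.sgn_of_mem (Forms.base_mem_deg R b), Forms.d_base,
        Forms.sgn_of_mem (Forms.one_mem_deg R _)]
      simp [Forms.d_base, hdb]
    | ho ω =>
      rw [Forms.sgn_of_mem (Forms.one_mem_deg R _), Forms.d_one,
        Forms.sgn_of_mem (Forms.dTwo_mem_deg R _)]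
      simp [Forms.d_one, hdd]
    | hadd x y hx hy =>
      simp only [map_add, hx, hy, neg_add, add_zero, and_self]
    | hmul x y hx hy =>
      simp only [Forms.d_mul', Forms.sgn_mul, map_add, hx, hy]
      refine ⟨?_, ?_⟩
      · simp [Forms.sgn_sgn, add_comm]
      · simp
  exact (hs x).2

theorem Forms.d_base_mul_d_base (R : Subalgebra k B) (u v : B) :
    Forms.d R (Forms.base R u) * Forms.d R (Forms.base R v) =
      Forms.d R (Forms.base R u * Forms.d R (Forms.base R v)) := by
  rw [Forms.d_mul (Forms.base_mem_deg R u), Forms.d_d]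
  simp

theorem DR.mk_mem_closed_two (R : Subalgebra k B) (u v : B) :
    DR.mk R (Forms.d R (Forms.base R u) * Forms.d R (Forms.base R v)) ∈ DR.closed R 2 := by
  refine ⟨⟨_, Forms.mul_mem_deg (p := 1) (q := 1) ?_ ?_, rfl⟩, ?_⟩
  · exact Forms.d_mem_deg (Forms.base_mem_deg R u)
  · exact Forms.d_mem_deg (Forms.base_mem_deg R v)
  · rw [SetLike.mem_coe, LinearMap.mem_ker, DR.d_mk, Forms.d_base_mul_d_base, Forms.d_d, map_zero]

/-- The class of the form `du dv` in `(DR²_R B)_closed`. -/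
def DR.dd (R : Subalgebra k B) (u v : B) : DR.closed R 2 :=
  ⟨DR.mk R (Forms.d R (Forms.base R u) * Forms.d R (Forms.base R v)),
    DR.mk_mem_closed_two R u v⟩

/-- The space `[B, B]^R` of those elements of the span `[B, B]` of the commutators of `B` which
commute with `R`. -/
def commInvariants (R : Subalgebra k B) : Submodule k B :=
  Submodule.span k {x : B | ∃ a b : B, x = a * b - b * a} ⊓
    (Subalgebra.centralizer k (R : Set B)).toSubmodule

end Forms

/-! ## Functoriality -/

section Functoriality

variable {k : Type w} [Field k] {B : Type u} [Ring B] [Algebra k B]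
  {C : Type v} [Ring C] [Algebra k C]

/-- The map `B ⊗_R B → C ⊗_S C` induced by an algebra map `f : B → C` with `f(R) ⊆ S`. -/
def RelTensor.map (R : Subalgebra k B) (S : Subalgebra k C) (f : B →ₐ[k] C)
    (hf : R.map f ≤ S) : RelTensor R →ₗ[k] RelTensor S :=
  rlift R ((balancing S).mkQ ∘ₗ TensorProduct.map f.toLinearMap f.toLinearMap) (by
    intro b r hr c
    have h := rtmul_balanced (R := S) (f b) (hf ⟨r, hr, rfl⟩) (f c)
    simp only [rtmul] at h
    simp only [LinearMap.comp_apply, TensorProduct.map_tmul, AlgHom.toLinearMap_apply, map_mul]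
    exact h)

@[simp] theorem RelTensor.map_rtmul (R : Subalgebra k B) (S : Subalgebra k C) (f : B →ₐ[k] C)
    (hf : R.map f ≤ S) (b c : B) :
    RelTensor.map R S f hf (rtmul R b c) = rtmul S (f b) (f c) := rfl

theorem mulMap_map (R : Subalgebra k B) (S : Subalgebra k C) (f : B →ₐ[k] C)
    (hf : R.map f ≤ S) (x : RelTensor R) :
    mulMap S (RelTensor.map R S f hf x) = f (mulMap R x) := by
  have : mulMap S ∘ₗ RelTensor.map R S f hf = f.toLinearMap ∘ₗ mulMap R :=
    rext (by intro b c; simp)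
  exact LinearMap.congr_fun this x

/-- The map `Ω¹_R B → Ω¹_S C` induced by `f`. -/
def OneForms.map (R : Subalgebra k B) (S : Subalgebra k C) (f : B →ₐ[k] C)
    (hf : R.map f ≤ S) : OneForms R →ₗ[k] OneForms S :=
  (RelTensor.map R S f hf).restrict (by
    intro x hx
    rw [LinearMap.mem_ker] at hx ⊢
    rw [mulMap_map, hx, map_zero])

theorem OneForms.map_lact (R : Subalgebra k B) (S : Subalgebra k C) (f : B →ₐ[k] C)
    (hf : R.map f ≤ S) (b : B) (ω : OneForms R) :
    OneForms.map R S f hf (lact R b ω) = lact S (f b) (OneForms.map R S f hf ω) := by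
  have : RelTensor.map R S f hf ∘ₗ leftMul R b = leftMul S (f b) ∘ₗ RelTensor.map R S f hf :=
    rext (by intro b c; simp)
  exact Subtype.ext (LinearMap.congr_fun this ω)

theorem OneForms.map_ract (R : Subalgebra k B) (S : Subalgebra k C) (f : B →ₐ[k] C)
    (hf : R.map f ≤ S) (b : B) (ω : OneForms R) :
    OneForms.map R S f hf (ract R b ω) = ract S (f b) (OneForms.map R S f hf ω) := by
  have : RelTensor.map R S f hf ∘ₗ rightMul R b = rightMul S (f b) ∘ₗ RelTensor.map R S f hf :=
    rext (by intro b c; simp)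
  exact Subtype.ext (LinearMap.congr_fun this ω)

theorem OneForms.map_univDer (R : Subalgebra k B) (S : Subalgebra k C) (f : B →ₐ[k] C)
    (hf : R.map f ≤ S) (b : B) :
    OneForms.map R S f hf (univDer R b) = univDer S (f b) := by
  apply Subtype.ext
  change RelTensor.map R S f hf (rtmul R 1 b - rtmul R b 1) = rtmul S 1 (f b) - rtmul S (f b) 1
  simp

/-- The algebra map `Ω_R B → Ω_S C` induced by `f`. -/
def Forms.map (R : Subalgebra k B) (S : Subalgebra k C) (f : B →ₐ[k] C)
    (hf : R.map f ≤ S) : Forms R →ₐ[k] Forms S :=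
  Forms.lift R ((Forms.base S).comp f) (Forms.one S ∘ₗ OneForms.map R S f hf)
    (by
      intro b ω
      simp only [LinearMap.comp_apply, OneForms.map_lact, AlgHom.comp_apply]
      exact (Forms.base_mul_one S _ _).symm)
    (by
      intro b ω
      simp only [LinearMap.comp_apply, OneForms.map_ract, AlgHom.comp_apply]
      exact (Forms.one_mul_base S _ _).symm)

@[simp] theorem Forms.map_base (R : Subalgebra k B) (S : Subalgebra k C) (f : B →ₐ[k] C)
    (hf : R.map f ≤ S) (b : B) :
    Forms.map R S f hf (Forms.base R b) = Forms.base S (f b) :=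
  Forms.lift_base R _ _ _ _ b

@[simp] theorem Forms.map_one' (R : Subalgebra k B) (S : Subalgebra k C) (f : B →ₐ[k] C)
    (hf : R.map f ≤ S) (ω : OneForms R) :
    Forms.map R S f hf (Forms.one R ω) = Forms.one S (OneForms.map R S f hf ω) :=
  Forms.lift_one R _ _ _ _ ω

theorem dTwo_map (R : Subalgebra k B) (S : Subalgebra k C) (f : B →ₐ[k] C)
    (hf : R.map f ≤ S) (x : RelTensor R) :
    dTwo S (RelTensor.map R S f hf x) = Forms.map R S f hf (dTwo R x) := by
  have : dTwo S ∘ₗ RelTensor.map R S f hf = (Forms.map R S f hf).toLinearMap ∘ₗ dTwo R := by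
    apply rext
    intro b c
    simp [OneForms.map_univDer]
  exact LinearMap.congr_fun this x

theorem Forms.map_d (R : Subalgebra k B) (S : Subalgebra k C) (f : B →ₐ[k] C)
    (hf : R.map f ≤ S) (x : Forms R) :
    Forms.map R S f hf (Forms.d R x) = Forms.d S (Forms.map R S f hf x) := by
  have h : Forms.map R S f hf (Forms.d R x) = Forms.d S (Forms.map R S f hf x) ∧
      Forms.map R S f hf (Forms.sgn R x) = Forms.sgn S (Forms.map R S f hf x) := by
    induction x using Forms.induction with
    | hb b => simp [Forms.d, Forms.sgn, OneForms.map_univDer]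
    | ho ω =>
      refine ⟨?_, by simp [Forms.sgn]⟩
      rw [Forms.d_one, Forms.map_one', Forms.d_one, ← dTwo_map]
      rfl
    | hadd x y hx hy => simp only [map_add, hx, hy, and_self]
    | hmul x y hx hy => simp only [map_mul, Forms.d_mul', Forms.sgn_mul, map_add, hx, hy, and_self]
  exact h.1

theorem Forms.map_mem_deg {R : Subalgebra k B} {S : Subalgebra k C} (f : B →ₐ[k] C)
    (hf : R.map f ≤ S) {n : ℕ} {x : Forms R} (hx : x ∈ Forms.deg R n) :
    Forms.map R S f hf x ∈ Forms.deg S n := by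
  refine Forms.deg_induction (P := fun n x => Forms.map R S f hf x ∈ Forms.deg S n)
    (by intro n x y hx hy; rw [map_add]; exact add_mem hx hy) ?_ ?_ hx
  · intro b
    rw [Forms.map_base]
    exact Forms.base_mem_deg S _
  · intro n x ω _ hx
    rw [map_mul, Forms.map_one']
    exact Forms.mul_mem_deg hx (Forms.one_mem_deg S _)

theorem superComm_le_comap_map (R : Subalgebra k B) (S : Subalgebra k C) (f : B →ₐ[k] C)
    (hf : R.map f ≤ S) :
    superComm R ≤ (superComm S).comap (Forms.map R S f hf).toLinearMap := by
  refine Submodule.span_le.2 ?_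
  rintro _ ⟨p, q, u, hu, v, hv, rfl⟩
  refine Submodule.subset_span
    ⟨p, q, _, Forms.map_mem_deg f hf hu, _, Forms.map_mem_deg f hf hv, ?_⟩
  simp

/-- The map `DR_R B → DR_S C` induced by `f`. -/
def DR.map (R : Subalgebra k B) (S : Subalgebra k C) (f : B →ₐ[k] C)
    (hf : R.map f ≤ S) : DR R →ₗ[k] DR S :=
  (superComm R).mapQ (superComm S) (Forms.map R S f hf).toLinearMap
    (superComm_le_comap_map R S f hf)

theorem DR.map_mk (R : Subalgebra k B) (S : Subalgebra k C) (f : B →ₐ[k] C)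
    (hf : R.map f ≤ S) (x : Forms R) :
    DR.map R S f hf (DR.mk R x) = DR.mk S (Forms.map R S f hf x) := rfl

/-- The map `(DRⁿ_R B)_closed → (DRⁿ_S C)_closed` induced by `f`. -/
def DR.closedMap (R : Subalgebra k B) (S : Subalgebra k C) (f : B →ₐ[k] C)
    (hf : R.map f ≤ S) (n : ℕ) : DR.closed R n →ₗ[k] DR.closed S n :=
  (DR.map R S f hf).restrict (by
    rintro _ ⟨⟨x, hx, rfl⟩, hd⟩
    refine ⟨⟨_, Forms.map_mem_deg f hf hx, rfl⟩, ?_⟩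
    rw [SetLike.mem_coe, LinearMap.mem_ker] at hd ⊢
    have h : DR.d S (DR.map R S f hf (DR.mk R x)) = DR.map R S f hf (DR.d R (DR.mk R x)) := by
      rw [DR.map_mk, DR.d_mk, DR.d_mk, DR.map_mk, Forms.map_d]
    rw [h, hd, map_zero])

end Functoriality

end NCForms

/-! ## The path algebra of a quiver -/

namespace NCForms

section PathAlg

/-- All paths of a quiver, including the trivial path at each vertex. -/
structure AnyPath (V : Type u) [Quiver.{v} V] where
  /-- the source -/
  src : V
  /-- the target -/
  tgt : V
  /-- the path -/
  path : Quiver.Path src tgt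

variable (k : Type w) [Field k] (V : Type u) [Quiver.{v} V]

/-- The path algebra of a quiver: the vector space with the paths as a basis. -/
def PathAlgebra : Type (max w u v) := AnyPath V →₀ k

instance : AddCommGroup (PathAlgebra k V) := inferInstanceAs (AddCommGroup (AnyPath V →₀ k))

instance : Module k (PathAlgebra k V) := inferInstanceAs (Module k (AnyPath V →₀ k))

/-- The basis of the path algebra given by the paths. -/
def PathAlgebra.basis : Module.Basis (AnyPath V) k (PathAlgebra k V) :=
  Module.Basis.ofRepr (LinearEquiv.refl k (AnyPath V →₀ k))

variable {V} in
/-- The basis element of the path algebra given by a path. -/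
def PathAlgebra.of (p : AnyPath V) : PathAlgebra k V := PathAlgebra.basis k V p

open Classical in
variable {V} in
/-- The product of two paths: `p` followed by `q` if `q` starts where `p` ends, and `0`
otherwise. -/
def PathAlgebra.pathMul (p q : AnyPath V) : PathAlgebra k V :=
  if h : q.src = p.tgt then
    PathAlgebra.of k ⟨p.src, q.tgt, p.path.comp (h ▸ q.path)⟩
  else 0

variable {k V}

theorem PathAlgebra.pathMul_comp {a b c : V} (p : Quiver.Path a b) (q : Quiver.Path b c) :
    PathAlgebra.pathMul k ⟨a, b, p⟩ ⟨b, c, q⟩ = PathAlgebra.of k ⟨a, c, p.comp q⟩ := by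
  simp [PathAlgebra.pathMul]

theorem PathAlgebra.pathMul_of_ne {p q : AnyPath V} (h : q.src ≠ p.tgt) :
    PathAlgebra.pathMul k p q = 0 := by
  simp [PathAlgebra.pathMul, h]

variable (k V) in
/-- The product of the path algebra, as the bilinear extension of the product of paths. -/
def PathAlgebra.mulLin : PathAlgebra k V →ₗ[k] PathAlgebra k V →ₗ[k] PathAlgebra k V :=
  (PathAlgebra.basis k V).constr k (fun p =>
    (PathAlgebra.basis k V).constr k (fun q => PathAlgebra.pathMul k p q))

theorem PathAlgebra.mulLin_of (p q : AnyPath V) :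
    PathAlgebra.mulLin k V (PathAlgebra.of k p) (PathAlgebra.of k q) =
      PathAlgebra.pathMul k p q := by
  unfold PathAlgebra.mulLin PathAlgebra.of
  rw [Module.Basis.constr_basis, Module.Basis.constr_basis]

theorem PathAlgebra.lin_ext {M : Type*} [AddCommGroup M] [Module k M]
    {f g : PathAlgebra k V →ₗ[k] M}
    (h : ∀ p, f (PathAlgebra.of k p) = g (PathAlgebra.of k p)) : f = g :=
  (PathAlgebra.basis k V).ext h

theorem PathAlgebra.mulLin_assoc (x y z : PathAlgebra k V) :
    PathAlgebra.mulLin k V (PathAlgebra.mulLin k V x y) z =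
      PathAlgebra.mulLin k V x (PathAlgebra.mulLin k V y z) := by
  let m := PathAlgebra.mulLin k V
  have key : (LinearMap.llcomp k _ _ _ m) ∘ₗ m =
      (LinearMap.llcomp k _ _ _).flip m ∘ₗ (LinearMap.llcomp k _ _ _) ∘ₗ m := by
    apply PathAlgebra.lin_ext
    rintro ⟨a, b, p⟩
    apply PathAlgebra.lin_ext
    rintro ⟨c, d, q⟩
    apply PathAlgebra.lin_ext
    rintro ⟨e, f, r⟩
    change m (m (PathAlgebra.of k ⟨a, b, p⟩) (PathAlgebra.of k ⟨c, d, q⟩))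
        (PathAlgebra.of k ⟨e, f, r⟩) =
      m (PathAlgebra.of k ⟨a, b, p⟩) (m (PathAlgebra.of k ⟨c, d, q⟩) (PathAlgebra.of k ⟨e, f, r⟩))
    simp only [m, PathAlgebra.mulLin_of]
    by_cases h1 : c = b
    · subst h1
      by_cases h2 : e = d
      · subst h2
        simp only [PathAlgebra.pathMul_comp, PathAlgebra.mulLin_of, Quiver.Path.comp_assoc]
      · rw [PathAlgebra.pathMul_of_ne (p := ⟨c, d, q⟩) h2, PathAlgebra.pathMul_comp,
          PathAlgebra.mulLin_of, PathAlgebra.pathMul_of_ne h2, map_zero]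
    · rw [PathAlgebra.pathMul_of_ne (p := ⟨a, b, p⟩) h1, map_zero, LinearMap.zero_apply]
      by_cases h2 : e = d
      · subst h2
        rw [PathAlgebra.pathMul_comp, PathAlgebra.mulLin_of, PathAlgebra.pathMul_of_ne h1]
      · rw [PathAlgebra.pathMul_of_ne (p := ⟨c, d, q⟩) h2, map_zero]
  exact LinearMap.congr_fun (LinearMap.congr_fun (LinearMap.congr_fun key x) y) z

variable (k) in
/-- The idempotent `e_i` of the path algebra given by the trivial path at the vertex `i`. -/
def PathAlgebra.e (i : V) : PathAlgebra k V := PathAlgebra.of k ⟨i, i, Quiver.Path.nil⟩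

open Classical in
theorem PathAlgebra.e_mulLin (i : V) (p : AnyPath V) :
    PathAlgebra.mulLin k V (PathAlgebra.e k i) (PathAlgebra.of k p) =
      if p.src = i then PathAlgebra.of k p else 0 := by
  rw [PathAlgebra.e, PathAlgebra.mulLin_of]
  split_ifs with h
  · subst h
    obtain ⟨a, b, p⟩ := p
    rw [PathAlgebra.pathMul_comp, Quiver.Path.nil_comp]
  · exact PathAlgebra.pathMul_of_ne h

open Classical in
theorem PathAlgebra.mulLin_e (i : V) (p : AnyPath V) :
    PathAlgebra.mulLin k V (PathAlgebra.of k p) (PathAlgebra.e k i) =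
      if i = p.tgt then PathAlgebra.of k p else 0 := by
  rw [PathAlgebra.e, PathAlgebra.mulLin_of]
  split_ifs with h
  · subst h
    obtain ⟨a, b, p⟩ := p
    rw [PathAlgebra.pathMul_comp, Quiver.Path.comp_nil]
  · exact PathAlgebra.pathMul_of_ne h

theorem PathAlgebra.sum_e_mulLin [Fintype V] (x : PathAlgebra k V) :
    PathAlgebra.mulLin k V (∑ i, PathAlgebra.e k i) x = x := by
  have : PathAlgebra.mulLin k V (∑ i, PathAlgebra.e k i) = LinearMap.id := by
    apply PathAlgebra.lin_ext
    intro p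
    simp only [map_sum, LinearMap.sum_apply, PathAlgebra.e_mulLin, LinearMap.id_apply]
    rw [Finset.sum_eq_single p.src (fun i _ hi => if_neg (Ne.symm hi))
      (fun h => absurd (Finset.mem_univ _) h), if_pos rfl]
  rw [this, LinearMap.id_apply]

theorem PathAlgebra.mulLin_sum_e [Fintype V] (x : PathAlgebra k V) :
    PathAlgebra.mulLin k V x (∑ i, PathAlgebra.e k i) = x := by
  have : (PathAlgebra.mulLin k V).flip (∑ i, PathAlgebra.e k i) = LinearMap.id := by
    apply PathAlgebra.lin_ext
    intro p
    simp only [map_sum, LinearMap.flip_apply, LinearMap.sum_apply, PathAlgebra.mulLin_e,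
      LinearMap.id_apply]
    rw [Finset.sum_eq_single p.tgt (fun i _ hi => if_neg hi)
      (fun h => absurd (Finset.mem_univ _) h), if_pos rfl]
  exact LinearMap.congr_fun this x

instance [Fintype V] : Ring (PathAlgebra k V) :=
  { (inferInstance : AddCommGroup (PathAlgebra k V)) with
    mul := fun x y => PathAlgebra.mulLin k V x y
    one := ∑ i, PathAlgebra.e k i
    left_distrib := fun x y z => map_add (PathAlgebra.mulLin k V x) y z
    right_distrib := fun x y z => LinearMap.map_add₂ (PathAlgebra.mulLin k V) x y z
    zero_mul := fun x => LinearMap.map_zero₂ (PathAlgebra.mulLin k V) x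
    mul_zero := fun x => map_zero (PathAlgebra.mulLin k V x)
    mul_assoc := PathAlgebra.mulLin_assoc
    one_mul := PathAlgebra.sum_e_mulLin
    mul_one := PathAlgebra.mulLin_sum_e }

instance [Fintype V] : Algebra k (PathAlgebra k V) :=
  Algebra.ofModule (fun r x y => LinearMap.map_smul₂ (PathAlgebra.mulLin k V) r x y)
    (fun r x y => map_smul (PathAlgebra.mulLin k V x) r y)

theorem PathAlgebra.one_def [Fintype V] :
    (1 : PathAlgebra k V) = ∑ i, PathAlgebra.e k i := rfl

theorem PathAlgebra.of_mul_of [Fintype V] (p q : AnyPath V) :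
    PathAlgebra.of k p * PathAlgebra.of k q = PathAlgebra.pathMul k p q :=
  PathAlgebra.mulLin_of p q

open Classical in
theorem PathAlgebra.e_mul_e [Fintype V] (i j : V) :
    PathAlgebra.e k i * PathAlgebra.e k j = if j = i then PathAlgebra.e k i else 0 :=
  PathAlgebra.mulLin_e j _

variable (k V) in
/-- The algebra map from `R = k ⊕ ⋯ ⊕ k`, one copy for each vertex, to the path algebra. -/
def PathAlgebra.vertexHom [Fintype V] : (V → k) →ₐ[k] PathAlgebra k V :=
  AlgHom.ofLinearMap
    { toFun := fun c => ∑ i, c i • PathAlgebra.e k i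
      map_add' := by intro x y; simp [add_smul, Finset.sum_add_distrib]
      map_smul' := by intro r x; simp [mul_smul, Finset.smul_sum] }
    (by simp [PathAlgebra.one_def])
    (by
      classical
      intro x y
      simp only [LinearMap.coe_mk, AddHom.coe_mk, Finset.sum_mul, Finset.mul_sum,
        smul_mul_smul_comm, PathAlgebra.e_mul_e]
      simp)

variable (k V) in
/-- The subalgebra `R` of the path algebra spanned by the trivial paths. -/
def PathAlgebra.vertexAlgebra [Fintype V] : Subalgebra k (PathAlgebra k V) :=
  (PathAlgebra.vertexHom k V).range

end PathAlg

end NCForms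

end

noncomputable section

namespace NCForms

/-! ## Contraction and Lie derivative along a derivation -/

section Contraction

variable {k : Type w} [Field k] {B : Type u} [Ring B] [Algebra k B]

/-! Two maps leave the same space `DR¹`: the differential onto closed 2-forms, and the commutator
map `c`, which sends the class of `u dv` to `∑ eᵢ (uv - vu) eᵢ` in `[A, A]^R`. Both are surjective
and they have the same kernel, so both targets are identified with one quotient of `DR¹`. Since `d(a
db) = da db`, the resulting isomorphism has the required values on the classes `da db`.

The differential is surjective by a Poincaré lemma (`exists_d_eq`). Let `eu` be the Euler
derivation, which multiplies a path by its length and kills `R`. Contraction with `eu` descends to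
`DR`, and the Lie derivative `L = d i + i d` is diagonalizable on `DRᵖ` with eigenvalues that are
integers at least `p`. In characteristic zero `L` is therefore bijective on `DRᵖ` for `p ≥ 1`, and
closed forms of positive degree are exact. Surjectivity of `c` is elementary: `x ↦ ∑ eᵢ x eᵢ` fixes
every element that commutes with `R`.

A closed 1-form is exact, hence the class of some `db = 1 db`, and `c` kills it because `1` is
central. The other inclusion of kernels is the heart of the proof. There is a linear map `Λ`
(`prim`) from `A` to 1-forms with `Λ(ab) = Λ(a) b + a Λ(b) + eu(a) db`. Modulo super-commutators the
first two terms are symmetric in `a` and `b`, so `Λ(ab - ba)` becomes `eu(a) db - eu(b) da`, which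
is the class of `i(da db)`. Hence `i(dx) = Λ(c(x))` on `DR¹` (`contractDR_d`). If `c(x) = 0` then
`L(dx) = d i(dx) = 0`, and injectivity of `L` in degree two gives `dx = 0`.

Naturality asks for no compatibility of `f` with `eu` or `Λ`: the classes `da db` span the closed
2-forms, so it is enough to compare values there, where only `f(R) = R'` is needed (`map_diag`). -/

/-- A `k`-linear derivation of `B` which vanishes on the subalgebra `R`. -/
structure RelDerivation (R : Subalgebra k B) where
  /-- the underlying linear map -/
  toLin : B →ₗ[k] B
  leibniz : ∀ a b, toLin (a * b) = toLin a * b + a * toLin b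
  map_base : ∀ r ∈ R, toLin r = 0

variable {R : Subalgebra k B}

/-- The map `u ⊗ v ↦ u D(v)` on `B ⊗_R B`. -/
def RelDerivation.contractTensor (D : RelDerivation R) : RelTensor R →ₗ[k] B :=
  rlift R (LinearMap.mul' k B ∘ₗ TensorProduct.map LinearMap.id D.toLin) (by
    intro b r hr c
    simp [D.leibniz, D.map_base r hr, mul_assoc])

@[simp] theorem RelDerivation.contractTensor_rtmul (D : RelDerivation R) (b c : B) :
    D.contractTensor (rtmul R b c) = b * D.toLin c := rfl

theorem RelDerivation.map_one (D : RelDerivation R) : D.toLin 1 = 0 :=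
  D.map_base 1 R.one_mem

theorem RelDerivation.contractTensor_univDer (D : RelDerivation R) (b : B) :
    D.contractTensor (univDer R b) = D.toLin b := by
  rw [univDer_coe, map_sub]
  simp [D.map_one]

theorem RelDerivation.contractTensor_leftMul (D : RelDerivation R) (b : B) (x : RelTensor R) :
    D.contractTensor (leftMul R b x) = b * D.contractTensor x := by
  have : D.contractTensor ∘ₗ leftMul R b = LinearMap.mulLeft k b ∘ₗ D.contractTensor :=
    rext (by intros; simp [mul_assoc])
  exact LinearMap.congr_fun this x

/-- The rule `D(vb) = D(v) b + v D(b)` makes `u ⊗ v ↦ u D(v)` fail right linearity by `uv D(b)`.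
This defect factors through multiplication, so it vanishes on 1-forms, where the contraction is a
bimodule map. -/
theorem RelDerivation.contractTensor_rightMul (D : RelDerivation R) (b : B) (x : RelTensor R) :
    D.contractTensor (rightMul R b x) = D.contractTensor x * b + mulMap R x * D.toLin b := by
  have : D.contractTensor ∘ₗ rightMul R b = LinearMap.mulRight k b ∘ₗ D.contractTensor +
      LinearMap.mulRight k (D.toLin b) ∘ₗ mulMap R :=
    rext (by intros; simp [mul_assoc, D.leibniz, mul_add])
  exact LinearMap.congr_fun this x

/-- The degree zero part of `contractHom`. -/
def contractBase (R : Subalgebra k B) : B →ₐ[k] Matrix (Fin 2) (Fin 2) (Forms R) :=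
  AlgHom.ofLinearMap (upper (Forms.base R).toLinearMap 0 (Forms.base R).toLinearMap)
    (by
      simp only [upper_apply, AlgHom.toLinearMap_apply, map_one, LinearMap.zero_apply]
      exact Matrix.one_fin_two.symm)
    (by
      intro b c
      simp [upper_apply])

theorem contractBase_apply (R : Subalgebra k B) (b : B) :
    contractBase R b = !![Forms.base R b, 0; 0, Forms.base R b] := rfl

/-- The algebra map `x ↦ [[(-1)^{deg x} x, i_D x], [0, x]]` which encodes the contraction. -/
def RelDerivation.contractHom (D : RelDerivation R) :
    Forms R →ₐ[k] Matrix (Fin 2) (Fin 2) (Forms R) :=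
  Forms.lift R (contractBase R)
    (upper (-Forms.one R)
      ((Forms.base R).toLinearMap ∘ₗ D.contractTensor ∘ₗ (OneForms R).subtype) (Forms.one R))
    (by
      intro b ω
      have h : D.contractTensor (lact R b ω : RelTensor R) = _ := D.contractTensor_leftMul b ω
      simp [upper_apply, contractBase_apply, h, ← Forms.base_mul_one])
    (by
      intro b ω
      have h : D.contractTensor (ract R b ω : RelTensor R) = _ := D.contractTensor_rightMul b ω
      have h0 : mulMap R (ω : RelTensor R) = 0 := ω.2
      simp [upper_apply, contractBase_apply, h, h0, ← Forms.one_mul_base])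

@[simp] theorem RelDerivation.contractHom_base (D : RelDerivation R) (b : B) :
    D.contractHom (Forms.base R b) = !![Forms.base R b, 0; 0, Forms.base R b] :=
  Forms.lift_base R _ _ _ _ b

@[simp] theorem RelDerivation.contractHom_one (D : RelDerivation R) (ω : OneForms R) :
    D.contractHom (Forms.one R ω) =
      !![-Forms.one R ω, Forms.base R (D.contractTensor ω); 0, Forms.one R ω] :=
  Forms.lift_one R _ _ _ _ ω

/-- The contraction `i_D`, a superderivation of `Ω_R B` of degree `-1`. -/
def RelDerivation.contract (D : RelDerivation R) : Forms R →ₗ[k] Forms R where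
  toFun x := D.contractHom x 0 1
  map_add' x y := by rw [map_add]; rfl
  map_smul' r x := by rw [map_smul]; rfl

/-- Once the diagonal is known to be the parity automorphism and the identity, the upper right
corner of a matrix product is exactly the graded Leibniz rule for `i_D`. -/
theorem RelDerivation.contractHom_eq (D : RelDerivation R) (x : Forms R) :
    D.contractHom x = !![Forms.sgn R x, D.contract x; 0, x] := by
  have h : D.contractHom x 1 0 = 0 ∧ D.contractHom x 1 1 = x ∧
      D.contractHom x 0 0 = Forms.sgn R x := by
    induction x using Forms.induction with
    | hb b => simp [Forms.sgn]
    | ho ω => simp [Forms.sgn]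
    | hadd x y hx hy => simp [hx, hy]
    | hmul x y hx hy => simp [Matrix.mul_apply, hx, hy, Forms.sgn_mul]
  ext i j
  fin_cases i <;> fin_cases j
  · exact h.2.2
  · rfl
  · exact h.1
  · exact h.2.1

theorem RelDerivation.contract_mul (D : RelDerivation R) (x y : Forms R) :
    D.contract (x * y) = D.contract x * y + Forms.sgn R x * D.contract y := by
  change D.contractHom (x * y) 0 1 = _
  rw [map_mul, D.contractHom_eq, D.contractHom_eq]
  simp [add_comm]

@[simp] theorem RelDerivation.contract_base (D : RelDerivation R) (b : B) :
    D.contract (Forms.base R b) = 0 := by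
  simp [RelDerivation.contract]

@[simp] theorem RelDerivation.contract_one (D : RelDerivation R) (ω : OneForms R) :
    D.contract (Forms.one R ω) = Forms.base R (D.contractTensor ω) := by
  simp [RelDerivation.contract]

/-- The two clauses avoid subtraction in `ℕ`: degree zero is killed, not kept in degree zero. They
are proved together because lowering the degree of `x ω` with `x` of degree zero uses the vanishing
clause. -/
theorem RelDerivation.contract_mem_deg (D : RelDerivation R) {n : ℕ} {x : Forms R}
    (hx : x ∈ Forms.deg R n) :
    (n = 0 → D.contract x = 0) ∧ ∀ m, n = m + 1 → D.contract x ∈ Forms.deg R m := by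
  refine Forms.deg_induction (P := fun n x =>
    (n = 0 → D.contract x = 0) ∧ ∀ m, n = m + 1 → D.contract x ∈ Forms.deg R m) ?_ ?_ ?_ hx
  · intro n x y hx hy
    refine ⟨fun h => by simp [hx.1 h, hy.1 h], fun m h => ?_⟩
    rw [map_add]
    exact add_mem (hx.2 m h) (hy.2 m h)
  · intro b
    simp
  · intro n x ω hx ih
    refine ⟨fun h => absurd h (Nat.succ_ne_zero n), fun m h => ?_⟩
    obtain rfl : n = m := Nat.succ_injective h
    rw [D.contract_mul, Forms.sgn_of_mem hx, D.contract_one]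
    refine add_mem ?_ (Forms.mul_mem_deg (q := 0) (Submodule.smul_mem _ _ hx)
      (Forms.base_mem_deg R _))
    cases n with
    | zero => simp [ih.1 rfl]
    | succ n => exact Forms.mul_mem_deg (ih.2 n rfl) (Forms.one_mem_deg R ω)

/-- This is the super-commutator of `i_D u` with `v`. The exponent `p + 1` stands for the true
degree `p - 1`, which has the same parity and exists also for `p = 0`. -/
theorem RelDerivation.contract_comm_mem (D : RelDerivation R) {p q : ℕ} {u v : Forms R}
    (hu : u ∈ Forms.deg R p) (hv : v ∈ Forms.deg R q) :
    D.contract u * v - (-1 : k) ^ ((p + 1) * q) • (v * D.contract u) ∈ superComm R := by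
  have h := D.contract_mem_deg hu
  cases p with
  | zero => simp [h.1 rfl]
  | succ p =>
    refine Submodule.subset_span ⟨_, _, _, h.2 p rfl, _, hv, ?_⟩
    have : (-1 : k) ^ ((p + 1 + 1) * q) = (-1) ^ (p * q) := by
      rw [add_assoc, add_mul, pow_add, pow_mul (-1 : k) (1 + 1) q]
      norm_num
    rw [this]

theorem RelDerivation.comm_contract_mem (D : RelDerivation R) {p q : ℕ} {u v : Forms R}
    (hu : u ∈ Forms.deg R p) (hv : v ∈ Forms.deg R q) :
    u * D.contract v - (-1 : k) ^ (p * (q + 1)) • (D.contract v * u) ∈ superComm R := by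
  have h := D.contract_mem_deg hv
  cases q with
  | zero => simp [h.1 rfl]
  | succ q =>
    refine Submodule.subset_span ⟨_, _, _, hu, _, h.2 q rfl, ?_⟩
    have : (-1 : k) ^ (p * (q + 1 + 1)) = (-1) ^ (p * q) := by
      rw [add_assoc, mul_add, pow_add, mul_comm p (1 + 1), pow_mul (-1 : k) (1 + 1) p]
      norm_num
    rw [this]

/-- As for any odd superderivation, `i[u, v] = [i u, v] + (-1)ᵖ [u, i v]`. -/
theorem RelDerivation.superComm_le_comap_contract (D : RelDerivation R) :
    superComm R ≤ (superComm R).comap D.contract := by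
  refine Submodule.span_le.2 ?_
  rintro _ ⟨p, q, u, hu, v, hv, rfl⟩
  have h := add_mem (D.contract_comm_mem hu hv)
    (Submodule.smul_mem _ ((-1 : k) ^ p) (D.comm_contract_mem hu hv))
  rw [SetLike.mem_coe, Submodule.mem_comap]
  convert h using 1
  rw [map_sub, map_smul, D.contract_mul, D.contract_mul, Forms.sgn_of_mem hu,
    Forms.sgn_of_mem hv]
  have e1 : (-1 : k) ^ p * (-1) ^ (p * (q + 1)) = (-1) ^ (p * q) := by
    have : (-1 : k) ^ p * (-1) ^ p = 1 := by rw [← mul_pow]; simp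
    rw [mul_add, pow_add, mul_one, mul_comm ((-1 : k) ^ (p * q)), ← mul_assoc, this, one_mul]
  have e2 : (-1 : k) ^ ((p + 1) * q) = (-1) ^ (p * q) * (-1) ^ q := by
    rw [add_mul, pow_add, one_mul]
  simp only [smul_mul_assoc, smul_sub, smul_add, smul_smul, e1, e2]
  abel

/-- The Lie derivative `L_D = d i_D + i_D d`. -/
def RelDerivation.lie (D : RelDerivation R) : Forms R →ₗ[k] Forms R :=
  Forms.d R ∘ₗ D.contract + D.contract ∘ₗ Forms.d R

theorem RelDerivation.lie_apply (D : RelDerivation R) (x : Forms R) :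
    D.lie x = Forms.d R (D.contract x) + D.contract (Forms.d R x) := rfl

theorem Forms.sgn_base (R : Subalgebra k B) (b : B) :
    Forms.sgn R (Forms.base R b) = Forms.base R b := by
  simp [Forms.sgn]

theorem Forms.sgn_one (R : Subalgebra k B) (ω : OneForms R) :
    Forms.sgn R (Forms.one R ω) = -Forms.one R ω := by
  simp [Forms.sgn]

theorem Forms.d_sgn (R : Subalgebra k B) (x : Forms R) :
    Forms.d R (Forms.sgn R x) = -Forms.sgn R (Forms.d R x) := by
  induction x using Forms.induction with
  | hb b => rw [Forms.sgn_base, Forms.d_base, Forms.sgn_one, neg_neg]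
  | ho ω =>
    rw [Forms.sgn_one, map_neg, Forms.d_one, Forms.sgn_of_mem (Forms.dTwo_mem_deg R _)]
    simp
  | hadd x y hx hy => rw [map_add, map_add, hx, hy, map_add, map_add, neg_add]
  | hmul x y hx hy =>
    simp only [Forms.d_mul', Forms.sgn_mul, map_add, hx, hy, Forms.sgn_sgn]
    noncomm_ring

theorem RelDerivation.contract_sgn (D : RelDerivation R) (x : Forms R) :
    D.contract (Forms.sgn R x) = -Forms.sgn R (D.contract x) := by
  induction x using Forms.induction with
  | hb b => simp [Forms.sgn_base]
  | ho ω => simp [Forms.sgn_base, Forms.sgn_one]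
  | hadd x y hx hy => rw [map_add, map_add, hx, hy, map_add, map_add, neg_add]
  | hmul x y hx hy =>
    simp only [D.contract_mul, Forms.sgn_mul, map_add, hx, hy, Forms.sgn_sgn]
    noncomm_ring

/-- The super-commutator of two odd superderivations is an even derivation: `d` and `i_D` both
anticommute with the parity automorphism, so the mixed terms cancel and no sign remains. -/
theorem RelDerivation.lie_mul (D : RelDerivation R) (x y : Forms R) :
    D.lie (x * y) = D.lie x * y + x * D.lie y := by
  simp only [D.lie_apply, D.contract_mul, Forms.d_mul', map_add, D.contract_sgn, Forms.d_sgn,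
    Forms.sgn_sgn]
  noncomm_ring

theorem RelDerivation.lie_base (D : RelDerivation R) (b : B) :
    D.lie (Forms.base R b) = Forms.base R (D.toLin b) := by
  simp [D.lie_apply, Forms.d_base, D.contractTensor_univDer]

theorem RelDerivation.lie_d (D : RelDerivation R) (x : Forms R) :
    D.lie (Forms.d R x) = Forms.d R (D.lie x) := by
  simp [D.lie_apply, Forms.d_d]

/-- The contraction on the relative de Rham complex. -/
def RelDerivation.contractDR (D : RelDerivation R) : DR R →ₗ[k] DR R :=
  (superComm R).mapQ (superComm R) D.contract D.superComm_le_comap_contract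

/-- The Lie derivative on the relative de Rham complex. -/
def RelDerivation.lieDR (D : RelDerivation R) : DR R →ₗ[k] DR R :=
  DR.d R ∘ₗ D.contractDR + D.contractDR ∘ₗ DR.d R

theorem RelDerivation.contractDR_mk (D : RelDerivation R) (x : Forms R) :
    D.contractDR (DR.mk R x) = DR.mk R (D.contract x) := rfl

theorem RelDerivation.lieDR_apply (D : RelDerivation R) (x : DR R) :
    D.lieDR x = DR.d R (D.contractDR x) + D.contractDR (DR.d R x) := rfl

theorem RelDerivation.lieDR_mk (D : RelDerivation R) (x : Forms R) :
    D.lieDR (DR.mk R x) = DR.mk R (D.lie x) := rfl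

theorem DR.d_d (R : Subalgebra k B) (x : DR R) : DR.d R (DR.d R x) = 0 := by
  obtain ⟨x, rfl⟩ := (superComm R).mkQ_surjective x
  change DR.mk R (Forms.d R (Forms.d R x)) = 0
  rw [Forms.d_d, map_zero]

theorem RelDerivation.contractDR_mem_deg (D : RelDerivation R) {n : ℕ} {x : DR R}
    (hx : x ∈ DR.deg R (n + 1)) : D.contractDR x ∈ DR.deg R n := by
  obtain ⟨x, hx, rfl⟩ := hx
  exact ⟨_, (D.contract_mem_deg hx).2 n rfl, rfl⟩

end Contraction

/-! ## Generation of forms in degree one -/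

section Generation

variable {k : Type w} [Field k] {B : Type u} [Ring B] [Algebra k B]

theorem univDer_of_mem {R : Subalgebra k B} {r : B} (hr : r ∈ R) : univDer R r = 0 := by
  apply Subtype.ext
  have h := rtmul_balanced (R := R) 1 hr 1
  rw [one_mul, mul_one] at h
  rw [univDer_coe, h, sub_self]
  rfl

/-- The section `b ↦ b ⊗ 1` of multiplication gives a projection onto 1-forms, and on a pure tensor
it yields `b ⊗ c - bc ⊗ 1 = b dc`. Thus the forms `u dv` span. -/
theorem sub_rtmul_mulMap_mem (R : Subalgebra k B) (x : RelTensor R) :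
    x - rtmul R (mulMap R x) 1 ∈ (Submodule.span k
      {ω : OneForms R | ∃ u v, ω = lact R u (univDer R v)}).map (OneForms R).subtype := by
  obtain ⟨x, rfl⟩ := Submodule.mkQ_surjective (balancing R) x
  have hadd : ∀ b c : B, rtmul R (b + c) 1 = rtmul R b 1 + rtmul R c 1 := by
    intro b c
    simp [rtmul, TensorProduct.add_tmul]
  induction x using TensorProduct.induction_on with
  | zero =>
    have : rtmul R (0 : B) 1 = 0 := by simp [rtmul]
    simp [this]
  | tmul b c =>
    refine ⟨_, Submodule.subset_span ⟨b, c, rfl⟩, ?_⟩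
    change leftMul R b (rtmul R 1 c - rtmul R c 1) = rtmul R b c - rtmul R (b * c) 1
    simp
  | add x y hx hy =>
    have h := add_mem hx hy
    rw [map_add, map_add, hadd]
    convert h using 1
    abel

theorem OneForms.span_eq_top (R : Subalgebra k B) :
    Submodule.span k {ω : OneForms R | ∃ u v, ω = lact R u (univDer R v)} = ⊤ := by
  refine eq_top_iff.2 fun ω _ => ?_
  obtain ⟨η, hη, h⟩ := sub_rtmul_mulMap_mem R (ω : RelTensor R)
  have h0 : mulMap R (ω : RelTensor R) = 0 := ω.2
  have : rtmul R (0 : B) 1 = 0 := by simp [rtmul]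
  rw [h0, this, sub_zero] at h
  rwa [← Subtype.ext h]

/-- A linear property of 1-forms may be checked on the forms `u dv`. -/
theorem OneForms.le_of_forall {R : Subalgebra k B} (S : Submodule k (OneForms R))
    (h : ∀ u v, lact R u (univDer R v) ∈ S) (ω : OneForms R) : ω ∈ S := by
  have hle : Submodule.span k {ω : OneForms R | ∃ u v, ω = lact R u (univDer R v)} ≤ S := by
    refine Submodule.span_le.2 ?_
    rintro _ ⟨u, v, rfl⟩
    exact h u v
  rw [OneForms.span_eq_top] at hle
  exact hle trivial

theorem Forms.deg_one_induction {R : Subalgebra k B} {S : Submodule k (Forms R)}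
    (h : ∀ u v, Forms.base R u * Forms.d R (Forms.base R v) ∈ S) {x : Forms R}
    (hx : x ∈ Forms.deg R 1) : x ∈ S := by
  have hle : Forms.deg R 1 ≤ S := by
    rw [Forms.deg, pow_one, Submodule.mul_le]
    rintro _ ⟨b, rfl⟩ _ ⟨ω, rfl⟩
    refine OneForms.le_of_forall
      (S.comap (LinearMap.mulLeft k (Forms.base R b) ∘ₗ Forms.one R)) (fun u v => ?_) ω
    have := h (b * u) v
    rw [map_mul, mul_assoc, Forms.d_base, Forms.base_mul_one] at this
    exact this
  exact hle hx

theorem DR.deg_one_induction {R : Subalgebra k B} {S : Submodule k (DR R)}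
    (h : ∀ u v, DR.mk R (Forms.base R u * Forms.d R (Forms.base R v)) ∈ S) {x : DR R}
    (hx : x ∈ DR.deg R 1) : x ∈ S := by
  obtain ⟨x, hx, rfl⟩ := hx
  exact Forms.deg_one_induction (S := S.comap (DR.mk R)) h hx

theorem DR.mk_comm {R : Subalgebra k B} {q : ℕ} (b : B) {x : Forms R} (hx : x ∈ Forms.deg R q) :
    DR.mk R (Forms.base R b * x) = DR.mk R (x * Forms.base R b) := by
  rw [← sub_eq_zero, ← map_sub]
  refine (Submodule.Quotient.mk_eq_zero _).2 (Submodule.subset_span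
    ⟨0, q, _, Forms.base_mem_deg R b, _, hx, ?_⟩)
  simp

end Generation

/-! ## Projection to one-forms and the commutator map -/

section OnePart

variable {k : Type w} [Field k] {B : Type u} [Ring B] [Algebra k B]

/-- The left action of `B` on itself and on `Ω¹_R B`, as an algebra map. -/
def actBase (R : Subalgebra k B) : B →ₐ[k] Module.End k (B × OneForms R) :=
  AlgHom.ofLinearMap
    { toFun := fun b => (LinearMap.mulLeft k b).prodMap (lact R b)
      map_add' := by
        intro b c
        refine LinearMap.ext fun x => Prod.ext (add_mul _ _ _) ?_
        obtain ⟨a, ω⟩ := x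
        refine OneForms.le_of_forall (LinearMap.eqLocus (lact R (b + c)) (lact R b + lact R c))
          (fun u v => Subtype.ext ?_) ω
        change leftMul R (b + c) (leftMul R u (rtmul R 1 v - rtmul R v 1)) =
          leftMul R b (leftMul R u (rtmul R 1 v - rtmul R v 1)) +
          leftMul R c (leftMul R u (rtmul R 1 v - rtmul R v 1))
        simp only [map_sub, leftMul_rtmul, add_mul]
        simp only [rtmul, TensorProduct.add_tmul, map_add]
        abel
      map_smul' := by
        intro r b
        refine LinearMap.ext fun x => Prod.ext (smul_mul_assoc _ _ _) ?_
        obtain ⟨a, ω⟩ := x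
        refine OneForms.le_of_forall (LinearMap.eqLocus (lact R (r • b)) (r • lact R b))
          (fun u v => Subtype.ext ?_) ω
        change leftMul R (r • b) (leftMul R u (rtmul R 1 v - rtmul R v 1)) =
          r • leftMul R b (leftMul R u (rtmul R 1 v - rtmul R v 1))
        simp only [map_sub, leftMul_rtmul, smul_mul_assoc]
        simp only [rtmul, ← TensorProduct.smul_tmul', map_smul, smul_sub] }
    (by
      refine LinearMap.ext fun x => Prod.ext (one_mul _) ?_
      obtain ⟨a, ω⟩ := x
      refine OneForms.le_of_forall (LinearMap.eqLocus (lact R 1) LinearMap.id)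
        (fun u v => Subtype.ext ?_) ω
      change leftMul R 1 (leftMul R u (rtmul R 1 v - rtmul R v 1)) =
        leftMul R u (rtmul R 1 v - rtmul R v 1)
      simp)
    (by
      intro b c
      refine LinearMap.ext fun x => Prod.ext (mul_assoc _ _ _) ?_
      obtain ⟨a, ω⟩ := x
      refine OneForms.le_of_forall (LinearMap.eqLocus (lact R (b * c)) (lact R b ∘ₗ lact R c))
        (fun u v => Subtype.ext ?_) ω
      change leftMul R (b * c) (leftMul R u (rtmul R 1 v - rtmul R v 1)) =
        leftMul R b (leftMul R c (leftMul R u (rtmul R 1 v - rtmul R v 1)))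
      simp [mul_assoc])

theorem actBase_apply (R : Subalgebra k B) (b : B) (x : B × OneForms R) :
    actBase R b x = (b * x.1, lact R b x.2) := rfl

/-- The right multiplication of 1-forms, linearly in `b`. -/
def ractLin (R : Subalgebra k B) (ω : OneForms R) : B →ₗ[k] OneForms R where
  toFun b := ract R b ω
  map_add' b c := by
    refine OneForms.le_of_forall (LinearMap.eqLocus (ract R (b + c)) (ract R b + ract R c))
      (fun u v => Subtype.ext ?_) ω
    change rightMul R (b + c) (leftMul R u (rtmul R 1 v - rtmul R v 1)) =
      rightMul R b (leftMul R u (rtmul R 1 v - rtmul R v 1)) +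
      rightMul R c (leftMul R u (rtmul R 1 v - rtmul R v 1))
    simp only [map_sub, leftMul_rtmul, rightMul_rtmul, mul_add]
    simp only [rtmul, TensorProduct.tmul_add, map_add]
    abel
  map_smul' r b := by
    refine OneForms.le_of_forall (LinearMap.eqLocus (ract R (r • b)) (r • ract R b))
      (fun u v => Subtype.ext ?_) ω
    change rightMul R (r • b) (leftMul R u (rtmul R 1 v - rtmul R v 1)) =
      r • rightMul R b (leftMul R u (rtmul R 1 v - rtmul R v 1))
    simp only [map_sub, leftMul_rtmul, rightMul_rtmul, mul_smul_comm]
    simp only [rtmul, TensorProduct.tmul_smul, map_smul, smul_sub]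

/-- The action of 1-forms on `B × Ω¹_R B`, with square zero. -/
def actOne (R : Subalgebra k B) : OneForms R →ₗ[k] Module.End k (B × OneForms R) where
  toFun ω := LinearMap.inr k B (OneForms R) ∘ₗ ractLin R ω ∘ₗ LinearMap.fst k B (OneForms R)
  map_add' ω η := by
    refine LinearMap.ext fun x => Prod.ext (by simp) ?_
    exact map_add (ract R x.1) ω η
  map_smul' r ω := by
    refine LinearMap.ext fun x => Prod.ext (by simp) ?_
    exact map_smul (ract R x.1) r ω

theorem actOne_apply (R : Subalgebra k B) (ω : OneForms R) (x : B × OneForms R) :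
    actOne R ω x = (0, ract R x.1 ω) := rfl

theorem lact_ract (R : Subalgebra k B) (b c : B) (ω : OneForms R) :
    lact R b (ract R c ω) = ract R c (lact R b ω) := by
  have : leftMul R b ∘ₗ rightMul R c = rightMul R c ∘ₗ leftMul R b :=
    rext (by intros; simp)
  exact Subtype.ext (LinearMap.congr_fun this ω)

theorem ract_ract (R : Subalgebra k B) (b c : B) (ω : OneForms R) :
    ract R c (ract R b ω) = ract R (b * c) ω := by
  have : rightMul R c ∘ₗ rightMul R b = rightMul R (b * c) :=
    rext (by intros; simp [mul_assoc])
  exact Subtype.ext (LinearMap.congr_fun this ω)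

theorem ract_one (R : Subalgebra k B) (ω : OneForms R) : ract R 1 ω = ω := by
  have : rightMul R 1 = LinearMap.id := rext (by intros; simp)
  exact Subtype.ext (LinearMap.congr_fun this ω)

/-- The action of `Ω_R B` on its quotient `B × Ω¹_R B` by the forms of degree at least two. -/
def actHom (R : Subalgebra k B) : Forms R →ₐ[k] Module.End k (B × OneForms R) :=
  Forms.lift R (C := Module.End k (B × OneForms R)) (actBase R) (actOne R)
    (by
      intro b ω
      refine LinearMap.ext fun x => ?_
      rw [Module.End.mul_apply, actOne_apply, actOne_apply, actBase_apply, mul_zero, lact_ract])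
    (by
      intro b ω
      refine LinearMap.ext fun x => ?_
      rw [Module.End.mul_apply, actOne_apply, actBase_apply, actOne_apply, ract_ract])

/-- The component of degree one of a form. -/
def onePart (R : Subalgebra k B) : Forms R →ₗ[k] OneForms R :=
  LinearMap.snd k B (OneForms R) ∘ₗ LinearMap.applyₗ (1, 0) ∘ₗ (actHom R).toLinearMap

theorem actHom_base (R : Subalgebra k B) (b : B) : actHom R (Forms.base R b) = actBase R b :=
  Forms.lift_base R _ _ _ _ b

theorem actHom_one (R : Subalgebra k B) (ω : OneForms R) :
    actHom R (Forms.one R ω) = actOne R ω :=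
  Forms.lift_one R _ _ _ _ ω

theorem onePart_base (R : Subalgebra k B) (b : B) : onePart R (Forms.base R b) = 0 := by
  change (actHom R (Forms.base R b) (1, 0)).2 = 0
  rw [actHom_base, actBase_apply, map_zero]

theorem onePart_one (R : Subalgebra k B) (ω : OneForms R) :
    onePart R (Forms.one R ω) = ω := by
  change (actHom R (Forms.one R ω) (1, 0)).2 = ω
  rw [actHom_one, actOne_apply, ract_one]

/-- A 1-form carries the whole module into `0 × Ω¹`, and a second one kills that part. The first
clause is what drives the induction for the second. As a result, `onePart` sees only degree one,
although `Ω` is presented by generators and relations with no grading built in. -/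
theorem actHom_of_mem {R : Subalgebra k B} {n : ℕ} {x : Forms R} (hx : x ∈ Forms.deg R n) :
    (1 ≤ n → ∀ ω : OneForms R, actHom R x (0, ω) = 0) ∧
      (2 ≤ n → ∀ y : B × OneForms R, actHom R x y = 0) := by
  refine Forms.deg_induction (P := fun n x =>
    (1 ≤ n → ∀ ω : OneForms R, actHom R x (0, ω) = 0) ∧
      (2 ≤ n → ∀ y : B × OneForms R, actHom R x y = 0)) ?_ ?_ ?_ hx
  · intro n x y hx hy
    refine ⟨fun h ω => ?_, fun h z => ?_⟩
    · rw [map_add, LinearMap.add_apply, hx.1 h, hy.1 h, add_zero]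
    · rw [map_add, LinearMap.add_apply, hx.2 h, hy.2 h, add_zero]
  · intro b
    simp
  · intro n x ω _ hx
    refine ⟨fun _ η => ?_, fun h z => ?_⟩
    · rw [map_mul, Module.End.mul_apply, actHom_one, actOne_apply]
      change actHom R x (0, ract R 0 ω) = 0
      have : ract R 0 ω = 0 := map_zero (ractLin R ω)
      rw [this]
      exact map_zero _
    · rw [map_mul, Module.End.mul_apply, actHom_one, actOne_apply]
      exact hx.1 (by omega) _

theorem onePart_of_two_le {R : Subalgebra k B} {n : ℕ} {x : Forms R} (hx : x ∈ Forms.deg R n)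
    (h : 2 ≤ n) : onePart R x = 0 := by
  change (actHom R x (1, 0)).2 = 0
  rw [(actHom_of_mem hx).2 h]
  rfl

theorem onePart_of_deg_zero {R : Subalgebra k B} {x : Forms R} (hx : x ∈ Forms.deg R 0) :
    onePart R x = 0 := by
  obtain ⟨b, rfl⟩ : x ∈ LinearMap.range (Forms.base R).toLinearMap := by
    simpa [Forms.deg] using hx
  exact onePart_base R b

theorem Forms.exists_of_mem_deg_one {R : Subalgebra k B} {x : Forms R}
    (hx : x ∈ Forms.deg R 1) : ∃ ω, x = Forms.one R ω := by
  have : x ∈ LinearMap.range (Forms.one R) := by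
    refine Forms.deg_one_induction (S := LinearMap.range (Forms.one R))
      (fun u v => ⟨lact R u (univDer R v), ?_⟩) hx
    rw [Forms.d_base, Forms.base_mul_one]
  obtain ⟨ω, rfl⟩ := this
  exact ⟨ω, rfl⟩

/-- A linear map on 1-forms which is a trace, extended by zero to the de Rham complex. -/
def traceLift (R : Subalgebra k B) {M : Type*} [AddCommGroup M] [Module k M]
    (τ : OneForms R →ₗ[k] M) (hτ : ∀ b ω, τ (lact R b ω) = τ (ract R b ω)) : DR R →ₗ[k] M :=
  (superComm R).liftQ (τ ∘ₗ onePart R) (by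
    have hcomm : ∀ u ∈ Forms.deg R 0, ∀ v ∈ Forms.deg R 1,
        τ (onePart R (u * v)) = τ (onePart R (v * u)) := by
      intro u hu v hv
      obtain ⟨b, rfl⟩ : u ∈ LinearMap.range (Forms.base R).toLinearMap := by
        simpa [Forms.deg] using hu
      obtain ⟨ω, rfl⟩ := Forms.exists_of_mem_deg_one hv
      rw [AlgHom.toLinearMap_apply, Forms.base_mul_one, Forms.one_mul_base, onePart_one,
        onePart_one, hτ]
    refine Submodule.span_le.2 ?_
    rintro _ ⟨p, q, u, hu, v, hv, rfl⟩
    have h1 := Forms.mul_mem_deg hu hv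
    have h2 := Forms.mul_mem_deg hv hu
    rw [SetLike.mem_coe, LinearMap.mem_ker, LinearMap.comp_apply, map_sub, map_smul]
    -- Only bidegrees `(0, 1)` and `(1, 0)` give commutators with a component in degree one; there
    -- the sign is trivial and the trace property of `τ` applies.
    obtain h | h : 2 ≤ p + q ∨ p + q ≤ 1 := by omega
    · rw [onePart_of_two_le h1 h, onePart_of_two_le h2 (by omega)]
      simp
    · obtain ⟨rfl, rfl⟩ | ⟨rfl, rfl⟩ | ⟨rfl, rfl⟩ :
          (p = 0 ∧ q = 0) ∨ (p = 0 ∧ q = 1) ∨ (p = 1 ∧ q = 0) := by omega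
      · rw [onePart_of_deg_zero h1, onePart_of_deg_zero h2]
        simp
      · simp [hcomm u hu v hv]
      · simp [hcomm v hv u hu])

theorem traceLift_mk_one (R : Subalgebra k B) {M : Type*} [AddCommGroup M] [Module k M]
    (τ : OneForms R →ₗ[k] M) (hτ : ∀ b ω, τ (lact R b ω) = τ (ract R b ω)) (ω : OneForms R) :
    traceLift R τ hτ (DR.mk R (Forms.one R ω)) = τ ω := by
  change τ (onePart R (Forms.one R ω)) = τ ω
  rw [onePart_one]

end OnePart

/-! ## The Poincaré lemma in the presence of an Euler derivation -/

section Poincare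

variable {k : Type w} [Field k] {B : Type u} [Ring B] [Algebra k B] {R : Subalgebra k B}

/-- The span of the forms of degree `p` which are eigenvectors of the Lie derivative, with an
eigenvalue at least `p`. -/
def RelDerivation.weightSpan (D : RelDerivation R) (p : ℕ) : Submodule k (Forms R) :=
  Submodule.span k {x | x ∈ Forms.deg R p ∧ ∃ n : ℕ, p ≤ n ∧ D.lie x = (n : k) • x}

/-- `L` is a derivation, so eigenvalues add under multiplication, as degrees do; the bound of the
eigenvalue by the degree is preserved. -/
theorem RelDerivation.mul_mem_weightSpan (D : RelDerivation R) {p q : ℕ} {x y : Forms R}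
    (hx : x ∈ D.weightSpan p) (hy : y ∈ D.weightSpan q) : x * y ∈ D.weightSpan (p + q) := by
  have h := Submodule.mul_mem_mul hx hy
  rw [weightSpan, weightSpan, Submodule.span_mul_span] at h
  refine Submodule.span_le.2 ?_ h
  rintro _ ⟨x, ⟨hx, m, hm, hxm⟩, y, ⟨hy, n, hn, hyn⟩, rfl⟩
  refine Submodule.subset_span ⟨Forms.mul_mem_deg hx hy, m + n, add_le_add hm hn, ?_⟩
  simp only [D.lie_mul, hxm, hyn, smul_mul_assoc, mul_smul_comm, Nat.cast_add, add_smul]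

/-- A derivation is an Euler derivation if its Lie derivative is diagonalizable with natural
numbers as eigenvalues, which are positive on exact 1-forms. -/
structure RelDerivation.IsEuler (D : RelDerivation R) : Prop where
  base_mem : ∀ b, Forms.base R b ∈ D.weightSpan 0
  d_base_mem : ∀ b, Forms.d R (Forms.base R b) ∈ D.weightSpan 1

variable {D : RelDerivation R}

/-- A form of degree `p` is a sum of products with `p` factors of the form `dv`, each contributing
at least one to the eigenvalue, and factors from `B`, which contribute at least zero. -/
theorem RelDerivation.IsEuler.mem_weightSpan (hD : D.IsEuler) {p : ℕ} {x : Forms R}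
    (hx : x ∈ Forms.deg R p) : x ∈ D.weightSpan p := by
  refine Forms.deg_induction (P := fun p x => x ∈ D.weightSpan p)
    (fun _ _ _ => add_mem) hD.base_mem (fun n x ω _ hx => ?_) hx
  refine D.mul_mem_weightSpan hx ?_
  refine Forms.deg_one_induction (fun u v => ?_) (Forms.one_mem_deg R ω)
  simpa using D.mul_mem_weightSpan (hD.base_mem u) (hD.d_base_mem v)

theorem RelDerivation.IsEuler.mem_span_DR (hD : D.IsEuler) {p : ℕ} {x : DR R}
    (hx : x ∈ DR.deg R p) :
    x ∈ Submodule.span k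
      {x | x ∈ DR.deg R p ∧ ∃ n : ℕ, p ≤ n ∧ D.lieDR x = (n : k) • x} := by
  obtain ⟨x, hx, rfl⟩ := hx
  have h : (D.weightSpan p).map (DR.mk R) ≤ Submodule.span k
      {x | x ∈ DR.deg R p ∧ ∃ n : ℕ, p ≤ n ∧ D.lieDR x = (n : k) • x} := by
    rw [weightSpan, Submodule.map_span_le]
    rintro x ⟨hx, n, hn, hxn⟩
    exact Submodule.subset_span ⟨⟨x, hx, rfl⟩, n, hn, by rw [D.lieDR_mk, hxn, map_smul]⟩
  exact h ⟨x, hD.mem_weightSpan hx, rfl⟩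

/-- An eigenvector is divided by its eigenvalue, which is a positive integer and so invertible in
characteristic zero. -/
theorem RelDerivation.IsEuler.exists_lieDR_eq [CharZero k] (hD : D.IsEuler) {p : ℕ} {x : DR R}
    (hx : x ∈ DR.deg R (p + 1)) : ∃ y ∈ DR.deg R (p + 1), D.lieDR y = x := by
  have h : Submodule.span k {x | x ∈ DR.deg R (p + 1) ∧
      ∃ n : ℕ, p + 1 ≤ n ∧ D.lieDR x = (n : k) • x} ≤ (DR.deg R (p + 1)).map D.lieDR := by
    refine Submodule.span_le.2 ?_
    rintro x ⟨hx, n, hn, hxn⟩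
    refine ⟨(n : k)⁻¹ • x, Submodule.smul_mem _ _ hx, ?_⟩
    have : (n : k) ≠ 0 := Nat.cast_ne_zero.2 (by omega)
    rw [map_smul, hxn, inv_smul_smul₀ this]
  exact h (hD.mem_span_DR hx)

/-- In infinite dimension this does not follow from surjectivity. The form lies in the 0-eigenspace
and also in the sum of the eigenspaces with nonzero eigenvalue, and eigenspaces are independent. -/
theorem RelDerivation.IsEuler.eq_zero_of_lieDR_eq_zero [CharZero k] (hD : D.IsEuler) {p : ℕ}
    {x : DR R} (hx : x ∈ DR.deg R (p + 1)) (h0 : D.lieDR x = 0) : x = 0 := by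
  have hle : Submodule.span k {x | x ∈ DR.deg R (p + 1) ∧
      ∃ n : ℕ, p + 1 ≤ n ∧ D.lieDR x = (n : k) • x} ≤
        ⨆ μ : k, ⨆ _ : μ ≠ 0, Module.End.eigenspace D.lieDR μ := by
    refine Submodule.span_le.2 ?_
    rintro x ⟨-, n, hn, hxn⟩
    have : (n : k) ≠ 0 := Nat.cast_ne_zero.2 (by omega)
    exact Submodule.mem_iSup_of_mem (n : k)
      (Submodule.mem_iSup_of_mem this (Module.End.mem_eigenspace_iff.2 hxn))
  refine Submodule.disjoint_def.1 (Module.End.eigenspaces_iSupIndep D.lieDR 0) x ?_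
    (hle (hD.mem_span_DR hx))
  rw [Module.End.mem_eigenspace_iff, h0, zero_smul]

/-- The Poincaré lemma. -/
theorem RelDerivation.IsEuler.exists_d_eq [CharZero k] (hD : D.IsEuler) {p : ℕ} {x : DR R}
    (hx : x ∈ DR.deg R (p + 1)) (h0 : DR.d R x = 0) : ∃ y ∈ DR.deg R p, DR.d R y = x := by
  obtain ⟨y, hy, rfl⟩ := hD.exists_lieDR_eq hx
  -- The form `x = L y` is closed, and `d L y = d i d y = L(dy)`. Injectivity of `L` in degree `p +
  -- 2` gives `dy = 0`, whence `x = d(i y)`.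
  have hdy : DR.d R y = 0 := by
    refine hD.eq_zero_of_lieDR_eq_zero (DR.d_mem_deg R hy) ?_
    rw [D.lieDR_apply, map_add, DR.d_d, zero_add] at h0
    rw [D.lieDR_apply, h0, DR.d_d, map_zero, add_zero]
  refine ⟨D.contractDR y, D.contractDR_mem_deg hy, ?_⟩
  rw [D.lieDR_apply, hdy, map_zero, add_zero]

end Poincare

/-! ## The Euler derivation of a path algebra -/

section Euler

variable {k : Type w} [Field k] {V : Type u} [Fintype V] [Quiver.{v} V]

theorem PathAlgebra.of_mul_of_comp {a b c : V} (p : Quiver.Path a b) (q : Quiver.Path b c) :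
    PathAlgebra.of k ⟨a, b, p⟩ * PathAlgebra.of k ⟨b, c, q⟩ =
      PathAlgebra.of k ⟨a, c, p.comp q⟩ := by
  rw [PathAlgebra.of_mul_of, PathAlgebra.pathMul_comp]

theorem PathAlgebra.of_mul_of_ne {p q : AnyPath V} (h : q.src ≠ p.tgt) :
    PathAlgebra.of k p * PathAlgebra.of k q = 0 := by
  rw [PathAlgebra.of_mul_of, PathAlgebra.pathMul_of_ne h]

theorem PathAlgebra.of_cons {a b c : V} (p : Quiver.Path a b) (x : b ⟶ c) :
    PathAlgebra.of k ⟨a, c, p.cons x⟩ =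
      PathAlgebra.of k ⟨a, b, p⟩ * PathAlgebra.of k ⟨b, c, x.toPath⟩ := by
  rw [PathAlgebra.of_mul_of_comp]
  rfl

theorem PathAlgebra.e_mul_of (p : AnyPath V) :
    PathAlgebra.e k p.src * PathAlgebra.of k p = PathAlgebra.of k p := by
  rw [PathAlgebra.e, PathAlgebra.of_mul_of_comp, Quiver.Path.nil_comp]

theorem PathAlgebra.of_mul_e (p : AnyPath V) :
    PathAlgebra.of k p * PathAlgebra.e k p.tgt = PathAlgebra.of k p := by
  rw [PathAlgebra.e, PathAlgebra.of_mul_of_comp, Quiver.Path.comp_nil]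

theorem PathAlgebra.e_mul_self (i : V) :
    PathAlgebra.e k i * PathAlgebra.e k i = PathAlgebra.e k i := by
  simp [PathAlgebra.e_mul_e]

theorem PathAlgebra.vertexHom_apply (c : V → k) :
    PathAlgebra.vertexHom k V c = ∑ i, c i • PathAlgebra.e k i := rfl

theorem PathAlgebra.e_mem (i : V) : PathAlgebra.e k i ∈ PathAlgebra.vertexAlgebra k V := by
  classical
  refine ⟨Pi.single i 1, ?_⟩
  change PathAlgebra.vertexHom k V (Pi.single i 1) = _
  rw [PathAlgebra.vertexHom_apply]
  simp [Pi.single_apply]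

/-- A linear map which vanishes on the trivial paths vanishes on the vertex algebra. -/
theorem PathAlgebra.map_eq_zero_of_mem {M : Type*} [AddCommGroup M] [Module k M]
    (f : PathAlgebra k V →ₗ[k] M) (hf : ∀ i, f (PathAlgebra.e k i) = 0)
    {r : PathAlgebra k V} (hr : r ∈ PathAlgebra.vertexAlgebra k V) : f r = 0 := by
  obtain ⟨c, rfl⟩ := hr
  change f (PathAlgebra.vertexHom k V c) = 0
  simp [PathAlgebra.vertexHom_apply, hf]

/-- A linear property of elements of the path algebra may be checked on paths. -/
theorem PathAlgebra.mem_of_forall (S : Submodule k (PathAlgebra k V))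
    (h : ∀ p, PathAlgebra.of k p ∈ S) (x : PathAlgebra k V) : x ∈ S := by
  have hle : Submodule.span k (Set.range (PathAlgebra.basis k V)) ≤ S := by
    refine Submodule.span_le.2 ?_
    rintro _ ⟨p, rfl⟩
    exact h p
  rw [Module.Basis.span_eq] at hle
  exact hle trivial

theorem PathAlgebra.bilin_ext {M : Type*} [AddCommGroup M] [Module k M]
    {f g : PathAlgebra k V →ₗ[k] PathAlgebra k V →ₗ[k] M}
    (h : ∀ p q, f (PathAlgebra.of k p) (PathAlgebra.of k q) =
      g (PathAlgebra.of k p) (PathAlgebra.of k q)) : f = g :=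
  PathAlgebra.lin_ext fun p => PathAlgebra.lin_ext fun q => h p q

variable (k V) in
/-- The map which multiplies each path by its length. -/
def PathAlgebra.eulerLin : PathAlgebra k V →ₗ[k] PathAlgebra k V :=
  (PathAlgebra.basis k V).constr k (fun p => (p.path.length : k) • PathAlgebra.of k p)

theorem PathAlgebra.eulerLin_of (p : AnyPath V) :
    PathAlgebra.eulerLin k V (PathAlgebra.of k p) = (p.path.length : k) • PathAlgebra.of k p :=
  Module.Basis.constr_basis _ _ _ _

theorem PathAlgebra.eulerLin_e (i : V) : PathAlgebra.eulerLin k V (PathAlgebra.e k i) = 0 := by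
  rw [PathAlgebra.e, PathAlgebra.eulerLin_of]
  simp

theorem PathAlgebra.eulerLin_mul (a b : PathAlgebra k V) :
    PathAlgebra.eulerLin k V (a * b) =
      PathAlgebra.eulerLin k V a * b + a * PathAlgebra.eulerLin k V b := by
  have key : (LinearMap.mul k (PathAlgebra k V)).compr₂ (PathAlgebra.eulerLin k V) =
      LinearMap.mul k (PathAlgebra k V) ∘ₗ PathAlgebra.eulerLin k V +
        (LinearMap.mul k (PathAlgebra k V)).compl₂ (PathAlgebra.eulerLin k V) := by
    apply PathAlgebra.bilin_ext
    rintro ⟨a, b, p⟩ ⟨c, d, q⟩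
    simp only [LinearMap.compr₂_apply, LinearMap.mul_apply', LinearMap.add_apply,
      LinearMap.comp_apply, LinearMap.compl₂_apply, PathAlgebra.eulerLin_of, smul_mul_assoc,
      mul_smul_comm]
    by_cases h : c = b
    · subst h
      rw [PathAlgebra.of_mul_of_comp, PathAlgebra.eulerLin_of, Quiver.Path.length_comp,
        Nat.cast_add, add_smul]
    · rw [PathAlgebra.of_mul_of_ne h]
      simp
  exact LinearMap.congr_fun (LinearMap.congr_fun key a) b

variable (k V) in
/-- The Euler derivation of the path algebra. -/
def PathAlgebra.euler : RelDerivation (PathAlgebra.vertexAlgebra k V) where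
  toLin := PathAlgebra.eulerLin k V
  leibniz := PathAlgebra.eulerLin_mul
  map_base _ hr := PathAlgebra.map_eq_zero_of_mem _ PathAlgebra.eulerLin_e hr

theorem PathAlgebra.euler_of (p : AnyPath V) :
    (PathAlgebra.euler k V).toLin (PathAlgebra.of k p) =
      (p.path.length : k) • PathAlgebra.of k p :=
  PathAlgebra.eulerLin_of p

theorem PathAlgebra.euler_e (i : V) : (PathAlgebra.euler k V).toLin (PathAlgebra.e k i) = 0 :=
  PathAlgebra.eulerLin_e i

theorem PathAlgebra.d_base_e (i : V) :
    Forms.d (PathAlgebra.vertexAlgebra k V) (Forms.base _ (PathAlgebra.e k i)) = 0 := by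
  rw [Forms.d_base, univDer_of_mem (PathAlgebra.e_mem i), map_zero]

-- A path is an eigenvector with its length as eigenvalue. The eigenvalue zero is absent from exact
-- 1-forms because the trivial paths lie in `R`, so their differentials vanish.
variable (k V) in
theorem PathAlgebra.isEuler_euler : (PathAlgebra.euler k V).IsEuler where
  base_mem b := by
    refine PathAlgebra.mem_of_forall
      (((PathAlgebra.euler k V).weightSpan 0).comap (Forms.base _).toLinearMap) (fun p => ?_) b
    refine Submodule.subset_span ⟨Forms.base_mem_deg _ _, p.path.length, Nat.zero_le _, ?_⟩
    rw [AlgHom.toLinearMap_apply, RelDerivation.lie_base, PathAlgebra.euler_of, map_smul]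
  d_base_mem b := by
    refine PathAlgebra.mem_of_forall (((PathAlgebra.euler k V).weightSpan 1).comap
      (Forms.d _ ∘ₗ (Forms.base (PathAlgebra.vertexAlgebra k V)).toLinearMap)) (fun p => ?_) b
    change Forms.d (PathAlgebra.vertexAlgebra k V) (Forms.base _ (PathAlgebra.of k p)) ∈
      (PathAlgebra.euler k V).weightSpan 1
    obtain ⟨a, b, p⟩ := p
    cases p with
    | nil =>
      have h : Forms.d (PathAlgebra.vertexAlgebra k V)
        (Forms.base _ (PathAlgebra.of k ⟨a, a, Quiver.Path.nil⟩)) = 0 := PathAlgebra.d_base_e a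
      rw [h]
      exact zero_mem _
    | cons p x =>
      refine Submodule.subset_span ⟨Forms.d_mem_deg (Forms.base_mem_deg _ _), p.length + 1,
        Nat.le_add_left _ _, ?_⟩
      rw [RelDerivation.lie_d, RelDerivation.lie_base, PathAlgebra.euler_of, map_smul, map_smul]
      rfl

end Euler

/-! ## A primitive of the cocycle `(a, b) ↦ eu(a) db` -/

section Primitive

variable {k : Type w} [Field k] {V : Type u} [Fintype V] [Quiver.{v} V]

variable (k) in
/-- The 1-form `∑ⱼ (j - 1) x₁ ⋯ dxⱼ ⋯ xₙ` attached to a path `x₁ ⋯ xₙ`. -/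
def PathAlgebra.primPath {a : V} : ∀ {b : V}, Quiver.Path a b →
    Forms (PathAlgebra.vertexAlgebra k V)
  | _, Quiver.Path.nil => 0
  | c, @Quiver.Path.cons _ _ _ b _ p x =>
    primPath p * Forms.base _ (PathAlgebra.of k ⟨b, c, x.toPath⟩) +
      (p.length : k) • (Forms.base _ (PathAlgebra.of k ⟨a, b, p⟩) *
        Forms.d _ (Forms.base _ (PathAlgebra.of k ⟨b, c, x.toPath⟩)))

theorem PathAlgebra.primPath_mem_deg {a b : V} (p : Quiver.Path a b) :
    PathAlgebra.primPath k p ∈ Forms.deg (PathAlgebra.vertexAlgebra k V) 1 := by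
  induction p with
  | nil => exact zero_mem _
  | cons p x ih =>
    exact add_mem (Forms.mul_mem_deg (q := 0) ih (Forms.base_mem_deg _ _))
      (Submodule.smul_mem _ _ (Forms.mul_mem_deg (p := 0) (q := 1) (Forms.base_mem_deg _ _)
        (Forms.d_mem_deg (Forms.base_mem_deg _ _))))

theorem Forms.d_base_mul {B : Type*} [Ring B] [Algebra k B] (R : Subalgebra k B) (a b : B) :
    Forms.d R (Forms.base R (a * b)) = Forms.d R (Forms.base R a) * Forms.base R b +
      Forms.base R a * Forms.d R (Forms.base R b) := by
  rw [map_mul, Forms.d_mul', Forms.sgn_base]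

/-- The coefficient of `dxⱼ` counts the arrows before `xⱼ`. Putting `p` in front of `q` raises each
coefficient in `q` by the length of `p`, and by the Leibniz rule the surplus adds up to that length
times `p dq`. -/
theorem PathAlgebra.primPath_comp {a b c : V} (p : Quiver.Path a b) (q : Quiver.Path b c) :
    PathAlgebra.primPath k (p.comp q) =
      PathAlgebra.primPath k p * Forms.base _ (PathAlgebra.of k ⟨b, c, q⟩) +
      Forms.base _ (PathAlgebra.of k ⟨a, b, p⟩) * PathAlgebra.primPath k q +
      (p.length : k) • (Forms.base _ (PathAlgebra.of k ⟨a, b, p⟩) *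
        Forms.d _ (Forms.base _ (PathAlgebra.of k ⟨b, c, q⟩))) := by
  induction q with
  | nil =>
    have hd : Forms.d (PathAlgebra.vertexAlgebra k V)
      (Forms.base _ (PathAlgebra.of k ⟨b, b, Quiver.Path.nil⟩)) = 0 := PathAlgebra.d_base_e b
    -- For trivial `q` the claim amounts to this right unit law, so it needs its own proof: the last
    -- arrow `x` satisfies `x e = x` and `dx e = dx`, the latter because `de = 0`.
    have he : PathAlgebra.primPath k p * Forms.base _ (PathAlgebra.of k ⟨b, b, Quiver.Path.nil⟩) =
        PathAlgebra.primPath k p := by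
      cases p with
      | nil => simp [PathAlgebra.primPath]
      | cons p x =>
        have h := PathAlgebra.of_mul_of_comp (k := k) x.toPath Quiver.Path.nil
        rw [Quiver.Path.comp_nil] at h
        rw [PathAlgebra.primPath, add_mul, mul_assoc, ← map_mul, h, smul_mul_assoc, mul_assoc]
        congr 3
        conv_rhs => rw [← h]
        rw [Forms.d_base_mul, hd, mul_zero, add_zero]
    rw [hd, he]
    simp [PathAlgebra.primPath]
  | cons q x ih =>
    rw [Quiver.Path.comp_cons, PathAlgebra.primPath, ih, PathAlgebra.primPath,
      PathAlgebra.of_cons q x, ← PathAlgebra.of_mul_of_comp p q, Forms.d_base_mul,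
      Quiver.Path.length_comp, Nat.cast_add]
    simp only [map_mul, mul_add, add_mul, smul_mul_assoc, mul_smul_comm, mul_assoc, smul_add,
      add_smul]
    abel

theorem PathAlgebra.base_e_mul_primPath {a b : V} (p : Quiver.Path a b) :
    Forms.base _ (PathAlgebra.e k a) * PathAlgebra.primPath k p = PathAlgebra.primPath k p := by
  have h := PathAlgebra.primPath_comp (k := k) Quiver.Path.nil p
  rw [Quiver.Path.nil_comp] at h
  conv_rhs => rw [h]
  simp [PathAlgebra.primPath, PathAlgebra.e]

theorem PathAlgebra.primPath_mul_base_e {a b : V} (p : Quiver.Path a b) :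
    PathAlgebra.primPath k p * Forms.base _ (PathAlgebra.e k b) = PathAlgebra.primPath k p := by
  have h := PathAlgebra.primPath_comp (k := k) p Quiver.Path.nil
  rw [Quiver.Path.comp_nil] at h
  have hd : Forms.d (PathAlgebra.vertexAlgebra k V)
    (Forms.base _ (PathAlgebra.of k ⟨b, b, Quiver.Path.nil⟩)) = 0 := PathAlgebra.d_base_e b
  rw [hd] at h
  conv_rhs => rw [h]
  simp [PathAlgebra.primPath, PathAlgebra.e]

variable (k V) in
/-- A linear map `Λ` with `Λ(ab) = Λ(a) b + a Λ(b) + eu(a) db`. -/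
def PathAlgebra.prim : PathAlgebra k V →ₗ[k] Forms (PathAlgebra.vertexAlgebra k V) :=
  (PathAlgebra.basis k V).constr k (fun p => PathAlgebra.primPath k p.path)

theorem PathAlgebra.prim_of (p : AnyPath V) :
    PathAlgebra.prim k V (PathAlgebra.of k p) = PathAlgebra.primPath k p.path :=
  Module.Basis.constr_basis _ _ _ _

theorem PathAlgebra.prim_e (i : V) : PathAlgebra.prim k V (PathAlgebra.e k i) = 0 := by
  rw [PathAlgebra.e, PathAlgebra.prim_of]
  rfl

theorem PathAlgebra.prim_mem_deg (a : PathAlgebra k V) :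
    PathAlgebra.prim k V a ∈ Forms.deg (PathAlgebra.vertexAlgebra k V) 1 := by
  refine PathAlgebra.mem_of_forall
    ((Forms.deg (PathAlgebra.vertexAlgebra k V) 1).comap (PathAlgebra.prim k V)) (fun p => ?_) a
  rw [Submodule.mem_comap, PathAlgebra.prim_of]
  exact PathAlgebra.primPath_mem_deg _

/-- The expression `eu(a) db` is a Hochschild 2-cocycle, the cup product of two derivations, and
must be a coboundary because path algebras have dimension at most one over `R`. The explicit
primitive reduces the check to `primPath_comp`. -/
theorem PathAlgebra.prim_mul (a b : PathAlgebra k V) :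
    PathAlgebra.prim k V (a * b) =
      PathAlgebra.prim k V a * Forms.base _ b + Forms.base _ a * PathAlgebra.prim k V b +
      Forms.base _ ((PathAlgebra.euler k V).toLin a) * Forms.d _ (Forms.base _ b) := by
  let R := PathAlgebra.vertexAlgebra k V
  let m := LinearMap.mul k (Forms R)
  let β := (Forms.base R).toLinearMap
  have key : (LinearMap.mul k (PathAlgebra k V)).compr₂ (PathAlgebra.prim k V) =
      m.compl₁₂ (PathAlgebra.prim k V) β + m.compl₁₂ β (PathAlgebra.prim k V) +
        m.compl₁₂ (β ∘ₗ (PathAlgebra.euler k V).toLin) (Forms.d R ∘ₗ β) := by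
    apply PathAlgebra.bilin_ext
    rintro p q
    change PathAlgebra.prim k V (PathAlgebra.of k p * PathAlgebra.of k q) =
      PathAlgebra.prim k V (PathAlgebra.of k p) * Forms.base R (PathAlgebra.of k q) +
      Forms.base R (PathAlgebra.of k p) * PathAlgebra.prim k V (PathAlgebra.of k q) +
      Forms.base R ((PathAlgebra.euler k V).toLin (PathAlgebra.of k p)) *
        Forms.d R (Forms.base R (PathAlgebra.of k q))
    rw [PathAlgebra.prim_of, PathAlgebra.prim_of, PathAlgebra.euler_of, map_smul, smul_mul_assoc]
    by_cases h : q.src = p.tgt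
    · obtain ⟨a, b, p⟩ := p
      obtain ⟨c, d, q⟩ := q
      dsimp only at h
      subst h
      rw [PathAlgebra.of_mul_of_comp, PathAlgebra.prim_of, PathAlgebra.primPath_comp]
    -- If the paths do not compose, each of the three terms contains the product of the end
    -- idempotent of `p` and the start idempotent of `q`, which is zero.
    · have he : Forms.base R (PathAlgebra.e k p.tgt) * Forms.base R (PathAlgebra.e k q.src) =
          0 := by
        rw [← map_mul, PathAlgebra.e_mul_e, if_neg h, map_zero]
      have hp : Forms.base R (PathAlgebra.of k p) * Forms.base R (PathAlgebra.e k q.src) =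
          0 := by
        rw [← PathAlgebra.of_mul_e p, map_mul, mul_assoc, he, mul_zero]
      have hq : Forms.d R (Forms.base R (PathAlgebra.of k q)) =
          Forms.base R (PathAlgebra.e k q.src) * Forms.d R (Forms.base R (PathAlgebra.of k q)) := by
        conv_lhs => rw [← PathAlgebra.e_mul_of q, Forms.d_base_mul, PathAlgebra.d_base_e,
          zero_mul, zero_add]
      have h1 : PathAlgebra.primPath k p.path * Forms.base R (PathAlgebra.of k q) = 0 := by
        rw [← PathAlgebra.primPath_mul_base_e p.path, ← PathAlgebra.e_mul_of q, map_mul,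
          mul_assoc, ← mul_assoc (Forms.base R (PathAlgebra.e k p.tgt)), he, zero_mul, mul_zero]
      have h2 : Forms.base R (PathAlgebra.of k p) * PathAlgebra.primPath k q.path = 0 := by
        rw [← PathAlgebra.base_e_mul_primPath q.path, ← mul_assoc, hp, zero_mul]
      rw [PathAlgebra.of_mul_of_ne h, map_zero, h1, h2, hq, ← mul_assoc, hp]
      simp
  exact LinearMap.congr_fun (LinearMap.congr_fun key a) b

end Primitive

/-! ## The commutator map -/

section Commutator

variable {k : Type w} [Field k] {V : Type u} [Fintype V] [Quiver.{v} V]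

variable (k V) in
/-- The projection `x ↦ ∑ eᵢ x eᵢ` to the centralizer of the vertex algebra. -/
def PathAlgebra.diag : PathAlgebra k V →ₗ[k] PathAlgebra k V :=
  ∑ i : V, LinearMap.mulLeft k (PathAlgebra.e k i) ∘ₗ LinearMap.mulRight k (PathAlgebra.e k i)

theorem PathAlgebra.diag_apply (x : PathAlgebra k V) :
    PathAlgebra.diag k V x = ∑ i : V, PathAlgebra.e k i * x * PathAlgebra.e k i := by
  simp [PathAlgebra.diag, mul_assoc]

theorem PathAlgebra.exists_smul_of_mem {r : PathAlgebra k V}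
    (hr : r ∈ PathAlgebra.vertexAlgebra k V) :
    ∃ c : V → k, ∀ i, r * PathAlgebra.e k i = c i • PathAlgebra.e k i ∧
      PathAlgebra.e k i * r = c i • PathAlgebra.e k i := by
  classical
  obtain ⟨c, rfl⟩ := hr
  refine ⟨c, fun i => ?_⟩
  change PathAlgebra.vertexHom k V c * _ = _ ∧ _ * PathAlgebra.vertexHom k V c = _
  simp [PathAlgebra.vertexHom_apply, Finset.sum_mul, Finset.mul_sum, PathAlgebra.e_mul_e]

/-- On either side of `eᵢ`, an element of `R` acts by the same scalar. This is what lets commutators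
descend to the tensor product over `R`. -/
theorem PathAlgebra.diag_mul_comm (x : PathAlgebra k V) {r : PathAlgebra k V}
    (hr : r ∈ PathAlgebra.vertexAlgebra k V) :
    PathAlgebra.diag k V (x * r) = PathAlgebra.diag k V (r * x) := by
  obtain ⟨c, hc⟩ := PathAlgebra.exists_smul_of_mem hr
  rw [PathAlgebra.diag_apply, PathAlgebra.diag_apply]
  refine Finset.sum_congr rfl fun i _ => ?_
  rw [← mul_assoc, mul_assoc _ r, (hc i).1, ← mul_assoc _ r, (hc i).2]
  simp

theorem PathAlgebra.commute_diag (x : PathAlgebra k V) {r : PathAlgebra k V}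
    (hr : r ∈ PathAlgebra.vertexAlgebra k V) :
    r * PathAlgebra.diag k V x = PathAlgebra.diag k V x * r := by
  obtain ⟨c, hc⟩ := PathAlgebra.exists_smul_of_mem hr
  rw [PathAlgebra.diag_apply, Finset.mul_sum, Finset.sum_mul]
  refine Finset.sum_congr rfl fun i _ => ?_
  rw [mul_assoc _ _ r, (hc i).2, ← mul_assoc, ← mul_assoc, (hc i).1]
  simp

theorem PathAlgebra.diag_eq_self {x : PathAlgebra k V}
    (hx : ∀ r ∈ PathAlgebra.vertexAlgebra k V, r * x = x * r) : PathAlgebra.diag k V x = x := by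
  have h : ∀ i, PathAlgebra.e k i * x * PathAlgebra.e k i = x * PathAlgebra.e k i := by
    intro i
    rw [hx _ (PathAlgebra.e_mem i), mul_assoc, PathAlgebra.e_mul_self]
  rw [PathAlgebra.diag_apply]
  simp only [h]
  rw [← Finset.mul_sum, ← PathAlgebra.one_def, mul_one]

theorem PathAlgebra.diag_mem_commInvariants {x : PathAlgebra k V}
    (hx : x ∈ Submodule.span k {x : PathAlgebra k V | ∃ a b, x = a * b - b * a}) :
    PathAlgebra.diag k V x ∈ commInvariants (PathAlgebra.vertexAlgebra k V) := by
  refine ⟨?_, ?_⟩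
  -- Since `∑ x eᵢ = x`, the projection differs from `x` by the commutators `[eᵢ, x eᵢ]`, so it
  -- stays inside `[A, A]`.
  · have h : PathAlgebra.diag k V x = x +
        ∑ i, (PathAlgebra.e k i * (x * PathAlgebra.e k i) -
          x * PathAlgebra.e k i * PathAlgebra.e k i) := by
      simp only [Finset.sum_sub_distrib, mul_assoc, PathAlgebra.e_mul_self]
      rw [← Finset.mul_sum, ← PathAlgebra.one_def, mul_one, PathAlgebra.diag_apply]
      simp [mul_assoc]
    rw [h]
    exact add_mem hx (sum_mem fun i _ => Submodule.subset_span ⟨_, _, rfl⟩)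
  · rw [SetLike.mem_coe, Subalgebra.mem_toSubmodule, Subalgebra.mem_centralizer_iff]
    intro r hr
    exact PathAlgebra.commute_diag x hr

variable (k V) in
/-- The map `u ⊗ v ↦ ∑ eᵢ (uv - vu) eᵢ`. -/
def PathAlgebra.commTensor : RelTensor (PathAlgebra.vertexAlgebra k V) →ₗ[k] PathAlgebra k V :=
  rlift _ (PathAlgebra.diag k V ∘ₗ (LinearMap.mul' k (PathAlgebra k V) -
    LinearMap.mul' k (PathAlgebra k V) ∘ₗ (TensorProduct.comm k _ _).toLinearMap)) (by
      intro b r hr c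
      have h := PathAlgebra.diag_mul_comm (c * b) hr
      simp only [LinearMap.comp_apply, LinearMap.sub_apply, LinearEquiv.coe_coe,
        TensorProduct.comm_tmul, LinearMap.mul'_apply, map_sub, mul_assoc] at h ⊢
      rw [h])

theorem PathAlgebra.commTensor_rtmul (b c : PathAlgebra k V) :
    PathAlgebra.commTensor k V (rtmul _ b c) = PathAlgebra.diag k V (b * c - c * b) := rfl

/-- From `[bu, v] - [u, vb] = [b, uv]`, the failure to be a trace factors through multiplication and
disappears on 1-forms. Hence the commutator map is defined on `DR`. -/
theorem PathAlgebra.commTensor_leftMul (b : PathAlgebra k V)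
    (x : RelTensor (PathAlgebra.vertexAlgebra k V)) :
    PathAlgebra.commTensor k V (leftMul _ b x) = PathAlgebra.commTensor k V (rightMul _ b x) +
      PathAlgebra.diag k V (b * mulMap _ x - mulMap _ x * b) := by
  have : PathAlgebra.commTensor k V ∘ₗ leftMul _ b =
      PathAlgebra.commTensor k V ∘ₗ rightMul _ b + PathAlgebra.diag k V ∘ₗ
        (LinearMap.mulLeft k b - LinearMap.mulRight k b) ∘ₗ mulMap _ := by
    apply rext
    intro u v
    simp only [LinearMap.comp_apply, LinearMap.add_apply, LinearMap.sub_apply, leftMul_rtmul,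
      rightMul_rtmul, PathAlgebra.commTensor_rtmul, mulMap_rtmul, LinearMap.mulLeft_apply,
      LinearMap.mulRight_apply, ← map_add]
    congr 1
    noncomm_ring
  exact LinearMap.congr_fun this x

variable (k V) in
/-- The map `u dv ↦ ∑ eᵢ (uv - vu) eᵢ` on the relative de Rham complex. -/
def PathAlgebra.commMap : DR (PathAlgebra.vertexAlgebra k V) →ₗ[k] PathAlgebra k V :=
  traceLift _ (PathAlgebra.commTensor k V ∘ₗ (OneForms _).subtype) (by
    intro b ω
    have h := PathAlgebra.commTensor_leftMul b (ω : RelTensor (PathAlgebra.vertexAlgebra k V))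
    have h0 : mulMap _ (ω : RelTensor (PathAlgebra.vertexAlgebra k V)) = 0 := ω.2
    rw [h0, mul_zero, zero_mul, sub_zero, map_zero, add_zero] at h
    exact h)

theorem PathAlgebra.commMap_mk (a b : PathAlgebra k V) :
    PathAlgebra.commMap k V (DR.mk _ (Forms.base _ a * Forms.d _ (Forms.base _ b))) =
      PathAlgebra.diag k V (a * b - b * a) := by
  rw [Forms.d_base, Forms.base_mul_one]
  refine (traceLift_mk_one _ _ _ _).trans ?_
  -- Here `a db = a ⊗ b - ab ⊗ 1`, and the second tensor contributes `[ab, 1] = 0`.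
  change PathAlgebra.commTensor k V (leftMul _ a (rtmul _ 1 b - rtmul _ b 1)) = _
  rw [map_sub, map_sub, leftMul_rtmul, leftMul_rtmul, PathAlgebra.commTensor_rtmul,
    PathAlgebra.commTensor_rtmul]
  simp

theorem DR.base_mul_d_base_mem {B : Type*} [Ring B] [Algebra k B] (R : Subalgebra k B)
    (a b : B) :
    DR.mk R (Forms.base R a * Forms.d R (Forms.base R b)) ∈ DR.deg R 1 :=
  ⟨_, Forms.mul_mem_deg (p := 0) (q := 1) (Forms.base_mem_deg R a)
    (Forms.d_mem_deg (Forms.base_mem_deg R b)), rfl⟩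

theorem PathAlgebra.commMap_mem {x : DR (PathAlgebra.vertexAlgebra k V)}
    (hx : x ∈ DR.deg (PathAlgebra.vertexAlgebra k V) 1) :
    PathAlgebra.commMap k V x ∈ commInvariants (PathAlgebra.vertexAlgebra k V) := by
  refine DR.deg_one_induction (S := (commInvariants (PathAlgebra.vertexAlgebra k V)).comap
    (PathAlgebra.commMap k V)) (fun a b => ?_) hx
  rw [Submodule.mem_comap, PathAlgebra.commMap_mk]
  exact PathAlgebra.diag_mem_commInvariants (Submodule.subset_span ⟨a, b, rfl⟩)

theorem PathAlgebra.exists_commMap_eq {y : PathAlgebra k V}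
    (hy : y ∈ commInvariants (PathAlgebra.vertexAlgebra k V)) :
    ∃ x ∈ DR.deg (PathAlgebra.vertexAlgebra k V) 1, PathAlgebra.commMap k V x = y := by
  have hle : (Submodule.span k {x : PathAlgebra k V | ∃ a b, x = a * b - b * a}).map
      (PathAlgebra.diag k V) ≤
        (DR.deg (PathAlgebra.vertexAlgebra k V) 1).map (PathAlgebra.commMap k V) := by
    rw [Submodule.map_span_le]
    rintro _ ⟨a, b, rfl⟩
    exact ⟨_, DR.base_mul_d_base_mem _ a b, PathAlgebra.commMap_mk a b⟩
  refine hle ⟨y, hy.1, PathAlgebra.diag_eq_self ?_⟩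
  have h := hy.2
  rwa [SetLike.mem_coe, Subalgebra.mem_toSubmodule, Subalgebra.mem_centralizer_iff] at h

theorem PathAlgebra.commMap_d {x : DR (PathAlgebra.vertexAlgebra k V)}
    (hx : x ∈ DR.deg (PathAlgebra.vertexAlgebra k V) 0) :
    PathAlgebra.commMap k V (DR.d _ x) = 0 := by
  obtain ⟨x, hx, rfl⟩ := hx
  obtain ⟨b, rfl⟩ : x ∈ LinearMap.range (Forms.base _).toLinearMap := by
    simpa [Forms.deg] using hx
  have h := PathAlgebra.commMap_mk (k := k) (V := V) 1 b
  rw [map_one, one_mul, one_mul, mul_one, sub_self, map_zero] at h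
  exact h

end Commutator

/-! ## The kernel of the commutator map -/

section Kernel

variable {k : Type w} [Field k] {V : Type u} [Fintype V] [Quiver.{v} V]

/-- As `Λ`, `eu` and `d` all vanish on `eᵢ`, one has `Λ(eᵢ x eᵢ) = eᵢ Λ(x) eᵢ`. Modulo
super-commutators this is `Λ(x) eᵢ`, and the `eᵢ` sum to one. -/
theorem PathAlgebra.mk_prim_diag (x : PathAlgebra k V) :
    DR.mk _ (PathAlgebra.prim k V (PathAlgebra.diag k V x)) =
      DR.mk _ (PathAlgebra.prim k V x) := by
  have h : ∀ i, PathAlgebra.prim k V (PathAlgebra.e k i * x * PathAlgebra.e k i) =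
      Forms.base _ (PathAlgebra.e k i) *
        (PathAlgebra.prim k V x * Forms.base _ (PathAlgebra.e k i)) := by
    intro i
    rw [PathAlgebra.prim_mul, PathAlgebra.prim_mul, PathAlgebra.prim_e, PathAlgebra.euler_e,
      PathAlgebra.d_base_e]
    simp [mul_assoc]
  have h' : ∀ i, DR.mk _ (PathAlgebra.prim k V (PathAlgebra.e k i * x * PathAlgebra.e k i)) =
      DR.mk _ (PathAlgebra.prim k V x * Forms.base _ (PathAlgebra.e k i)) := by
    intro i
    rw [h, DR.mk_comm _ (Forms.mul_mem_deg (PathAlgebra.prim_mem_deg x) (Forms.base_mem_deg _ _)),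
      mul_assoc, ← map_mul, PathAlgebra.e_mul_self]
  rw [PathAlgebra.diag_apply, map_sum, map_sum]
  simp only [h']
  rw [← map_sum, ← Finset.mul_sum, ← map_sum, ← PathAlgebra.one_def, map_one, mul_one]

/-- The key identity, checked on `a db`. There `i(da db) = eu(a) db - da eu(b)`, while in `Λ(ab) -
Λ(ba)` the terms `Λ(a) b` and `b Λ(a)`, and likewise `a Λ(b)` and `Λ(b) a`, cancel by cyclicity. -/
theorem PathAlgebra.contractDR_d {x : DR (PathAlgebra.vertexAlgebra k V)}
    (hx : x ∈ DR.deg (PathAlgebra.vertexAlgebra k V) 1) :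
    (PathAlgebra.euler k V).contractDR (DR.d _ x) =
      DR.mk _ (PathAlgebra.prim k V (PathAlgebra.commMap k V x)) := by
  refine DR.deg_one_induction (S := LinearMap.eqLocus
    ((PathAlgebra.euler k V).contractDR ∘ₗ DR.d _)
    (DR.mk _ ∘ₗ PathAlgebra.prim k V ∘ₗ PathAlgebra.commMap k V)) (fun a b => ?_) hx
  rw [LinearMap.mem_eqLocus]
  simp only [LinearMap.comp_apply]
  have hb : ∀ b : PathAlgebra k V, Forms.d (PathAlgebra.vertexAlgebra k V) (Forms.base _ b) ∈
      Forms.deg (PathAlgebra.vertexAlgebra k V) 1 :=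
    fun b => Forms.d_mem_deg (Forms.base_mem_deg _ b)
  have hc : ∀ b : PathAlgebra k V, (PathAlgebra.euler k V).contract
      (Forms.d _ (Forms.base _ b)) = Forms.base _ ((PathAlgebra.euler k V).toLin b) := by
    intro b
    rw [Forms.d_base, RelDerivation.contract_one, RelDerivation.contractTensor_univDer]
  rw [PathAlgebra.commMap_mk, PathAlgebra.mk_prim_diag, DR.d_mk, ← Forms.d_base_mul_d_base,
    RelDerivation.contractDR_mk, RelDerivation.contract_mul, hc, hc, Forms.sgn_of_mem (hb a),
    map_sub, PathAlgebra.prim_mul, PathAlgebra.prim_mul]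
  simp only [map_add, map_sub, pow_one, neg_smul, one_smul, neg_mul, map_neg,
    DR.mk_comm a (PathAlgebra.prim_mem_deg b), DR.mk_comm b (PathAlgebra.prim_mem_deg a),
    DR.mk_comm ((PathAlgebra.euler k V).toLin b) (hb a)]
  abel

theorem PathAlgebra.d_eq_zero_iff [CharZero k] {x : DR (PathAlgebra.vertexAlgebra k V)}
    (hx : x ∈ DR.deg (PathAlgebra.vertexAlgebra k V) 1) :
    DR.d _ x = 0 ↔ PathAlgebra.commMap k V x = 0 := by
  refine ⟨fun h => ?_, fun h => ?_⟩
  · obtain ⟨y, hy, rfl⟩ := (PathAlgebra.isEuler_euler k V).exists_d_eq hx h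
    exact PathAlgebra.commMap_d hy
  · refine (PathAlgebra.isEuler_euler k V).eq_zero_of_lieDR_eq_zero (DR.d_mem_deg _ hx) ?_
    rw [RelDerivation.lieDR_apply, DR.d_d, map_zero, add_zero, PathAlgebra.contractDR_d hx, h,
      map_zero, map_zero, map_zero]

end Kernel

/-! ## The isomorphism -/

section Isomorphism

variable (k : Type w) [Field k] (V : Type u) [Fintype V] [Quiver.{v} V]

/-- The differential from 1-forms to closed 2-forms. -/
def PathAlgebra.dOne : DR.deg (PathAlgebra.vertexAlgebra k V) 1 →ₗ[k]
    DR.closed (PathAlgebra.vertexAlgebra k V) 2 :=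
  LinearMap.codRestrict _ (DR.d _ ∘ₗ (DR.deg _ 1).subtype)
    (fun x => ⟨DR.d_mem_deg _ x.2, DR.d_d _ _⟩)

/-- The commutator map from 1-forms to invariants. -/
def PathAlgebra.commOne : DR.deg (PathAlgebra.vertexAlgebra k V) 1 →ₗ[k]
    commInvariants (PathAlgebra.vertexAlgebra k V) :=
  LinearMap.codRestrict _ (PathAlgebra.commMap k V ∘ₗ (DR.deg _ 1).subtype)
    (fun x => PathAlgebra.commMap_mem x.2)

variable {k V}

theorem PathAlgebra.dOne_coe (x : DR.deg (PathAlgebra.vertexAlgebra k V) 1) :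
    (PathAlgebra.dOne k V x : DR (PathAlgebra.vertexAlgebra k V)) = DR.d _ x := rfl

theorem PathAlgebra.commOne_coe (x : DR.deg (PathAlgebra.vertexAlgebra k V) 1) :
    (PathAlgebra.commOne k V x : PathAlgebra k V) = PathAlgebra.commMap k V x := rfl

theorem PathAlgebra.commOne_surjective : Function.Surjective (PathAlgebra.commOne k V) := by
  rintro ⟨y, hy⟩
  obtain ⟨x, hx, rfl⟩ := PathAlgebra.exists_commMap_eq hy
  exact ⟨⟨x, hx⟩, rfl⟩

theorem PathAlgebra.dOne_surjective [CharZero k] :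
    Function.Surjective (PathAlgebra.dOne k V) := by
  rintro ⟨y, hy, h0⟩
  obtain ⟨x, hx, rfl⟩ := (PathAlgebra.isEuler_euler k V).exists_d_eq (p := 1) hy h0
  exact ⟨⟨x, hx⟩, rfl⟩

theorem PathAlgebra.ker_dOne [CharZero k] :
    LinearMap.ker (PathAlgebra.dOne k V) = LinearMap.ker (PathAlgebra.commOne k V) := by
  ext x
  rw [LinearMap.mem_ker, LinearMap.mem_ker, ← Subtype.coe_inj, ← Subtype.coe_inj,
    PathAlgebra.dOne_coe, PathAlgebra.commOne_coe]
  exact PathAlgebra.d_eq_zero_iff x.2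

variable (k V) in
/-- The isomorphism from closed 2-forms to invariant commutators. -/
def PathAlgebra.closedEquiv [CharZero k] : DR.closed (PathAlgebra.vertexAlgebra k V) 2 ≃ₗ[k]
    commInvariants (PathAlgebra.vertexAlgebra k V) :=
  ((PathAlgebra.dOne k V).quotKerEquivOfSurjective PathAlgebra.dOne_surjective).symm ≪≫ₗ
    Submodule.quotEquivOfEq _ _ PathAlgebra.ker_dOne ≪≫ₗ
    (PathAlgebra.commOne k V).quotKerEquivOfSurjective PathAlgebra.commOne_surjective

theorem PathAlgebra.closedEquiv_dOne [CharZero k]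
    (x : DR.deg (PathAlgebra.vertexAlgebra k V) 1) :
    PathAlgebra.closedEquiv k V (PathAlgebra.dOne k V x) = PathAlgebra.commOne k V x := by
  have h : ((PathAlgebra.dOne k V).quotKerEquivOfSurjective PathAlgebra.dOne_surjective).symm
      (PathAlgebra.dOne k V x) = Submodule.Quotient.mk x := by
    rw [LinearEquiv.symm_apply_eq]
    rfl
  rw [PathAlgebra.closedEquiv, LinearEquiv.trans_apply, LinearEquiv.trans_apply, h]
  rfl

theorem PathAlgebra.dOne_mk (a b : PathAlgebra k V) :
    PathAlgebra.dOne k V ⟨_, DR.base_mul_d_base_mem _ a b⟩ = DR.dd _ a b := by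
  apply Subtype.ext
  rw [PathAlgebra.dOne_coe, DR.d_mk, ← Forms.d_base_mul_d_base]
  rfl

theorem PathAlgebra.closedEquiv_dd [CharZero k] (a b : PathAlgebra k V) :
    (PathAlgebra.closedEquiv k V (DR.dd _ a b) : PathAlgebra k V) =
      PathAlgebra.diag k V (a * b - b * a) := by
  rw [← PathAlgebra.dOne_mk, PathAlgebra.closedEquiv_dOne, PathAlgebra.commOne_coe,
    PathAlgebra.commMap_mk]

/-- By the Poincaré lemma every closed 2-form is the differential of a combination of forms `a db`,
so the classes `da db` span. This makes the values on them determine the isomorphism. -/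
theorem PathAlgebra.closed_induction [CharZero k]
    (S : Submodule k (DR.closed (PathAlgebra.vertexAlgebra k V) 2))
    (h : ∀ a b, DR.dd _ a b ∈ S) (x : DR.closed (PathAlgebra.vertexAlgebra k V) 2) : x ∈ S := by
  obtain ⟨⟨x, hx⟩, rfl⟩ := PathAlgebra.dOne_surjective x
  have key : x ∈ (S.comap (PathAlgebra.dOne k V)).map (DR.deg _ 1).subtype := by
    refine DR.deg_one_induction (fun a b => ?_) hx
    exact ⟨⟨_, DR.base_mul_d_base_mem _ a b⟩,
      by rw [SetLike.mem_coe, Submodule.mem_comap, PathAlgebra.dOne_mk]; exact h a b, rfl⟩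
  obtain ⟨y, hy, rfl⟩ := key
  exact hy

variable {W : Type u} [Fintype W] [Quiver.{v} W]

/-- The map `f` need not send vertex idempotents to vertex idempotents. Still, `f(diag x)` commutes
with `f(R) = R'`, so the target projection fixes it; under that projection one factor `f(eᵢ)` can be
moved across to merge with the other, and the `f(eᵢ)` sum to one. -/
theorem PathAlgebra.map_diag (f : PathAlgebra k V →ₐ[k] PathAlgebra k W)
    (hf : (PathAlgebra.vertexAlgebra k V).map f = PathAlgebra.vertexAlgebra k W)
    (x : PathAlgebra k V) :
    f (PathAlgebra.diag k V x) = PathAlgebra.diag k W (f x) := by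
  have hmem : ∀ r ∈ PathAlgebra.vertexAlgebra k V, f r ∈ PathAlgebra.vertexAlgebra k W :=
    fun r hr => hf ▸ ⟨r, hr, rfl⟩
  have h1 : PathAlgebra.diag k W (f (PathAlgebra.diag k V x)) = f (PathAlgebra.diag k V x) := by
    refine PathAlgebra.diag_eq_self fun r hr => ?_
    obtain ⟨s, hs, rfl⟩ : r ∈ (PathAlgebra.vertexAlgebra k V).map f := hf ▸ hr
    change f s * _ = _ * f s
    rw [← map_mul, ← map_mul, PathAlgebra.commute_diag x hs]
  have h2 : ∀ i, PathAlgebra.diag k W (f (PathAlgebra.e k i * x * PathAlgebra.e k i)) =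
      PathAlgebra.diag k W (f (PathAlgebra.e k i) * f x) := by
    intro i
    rw [map_mul, PathAlgebra.diag_mul_comm _ (hmem _ (PathAlgebra.e_mem i)), ← map_mul,
      ← mul_assoc, PathAlgebra.e_mul_self, map_mul]
  rw [← h1, PathAlgebra.diag_apply x, map_sum, map_sum]
  simp only [h2]
  rw [← map_sum, ← Finset.sum_mul, ← map_sum, ← PathAlgebra.one_def, map_one, one_mul]

theorem DR.closedMap_dd {B C : Type*} [Ring B] [Algebra k B] [Ring C] [Algebra k C]
    {R : Subalgebra k B} {S : Subalgebra k C} (f : B →ₐ[k] C) (hf : R.map f ≤ S) (a b : B) :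
    DR.closedMap R S f hf 2 (DR.dd R a b) = DR.dd S (f a) (f b) := by
  apply Subtype.ext
  change DR.map R S f hf (DR.mk R _) = DR.mk S _
  rw [DR.map_mk, map_mul, Forms.map_d, Forms.map_d, Forms.map_base, Forms.map_base]

theorem PathAlgebra.closedEquiv_closedMap [CharZero k]
    (f : PathAlgebra k V →ₐ[k] PathAlgebra k W)
    (hf : (PathAlgebra.vertexAlgebra k V).map f = PathAlgebra.vertexAlgebra k W)
    (x : DR.closed (PathAlgebra.vertexAlgebra k V) 2) :
    (PathAlgebra.closedEquiv k W (DR.closedMap _ _ f hf.le 2 x) : PathAlgebra k W) =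
      f (PathAlgebra.closedEquiv k V x : PathAlgebra k V) := by
  refine PathAlgebra.closed_induction (LinearMap.eqLocus
    ((commInvariants (PathAlgebra.vertexAlgebra k W)).subtype ∘ₗ
      (PathAlgebra.closedEquiv k W).toLinearMap ∘ₗ DR.closedMap _ _ f hf.le 2)
    (f.toLinearMap ∘ₗ (commInvariants (PathAlgebra.vertexAlgebra k V)).subtype ∘ₗ
      (PathAlgebra.closedEquiv k V).toLinearMap)) (fun a b => ?_) x
  change (PathAlgebra.closedEquiv k W (DR.closedMap _ _ f hf.le 2 (DR.dd _ a b)) :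
      PathAlgebra k W) = f (PathAlgebra.closedEquiv k V (DR.dd _ a b) : PathAlgebra k V)
  rw [DR.closedMap_dd, PathAlgebra.closedEquiv_dd, PathAlgebra.closedEquiv_dd,
    PathAlgebra.map_diag f hf]
  simp

end Isomorphism

end NCForms

end

theorem mainTheorem6 (k : Type w) [Field k] [CharZero k] :
    ∃ Φ : ∀ (V : Type u) [Fintype V] [Quiver.{v} V],
        NCForms.DR.closed (NCForms.PathAlgebra.vertexAlgebra k V) 2 ≃ₗ[k]
          NCForms.commInvariants (NCForms.PathAlgebra.vertexAlgebra k V),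
      (∀ (V : Type u) [Fintype V] [Quiver.{v} V] (a b : NCForms.PathAlgebra k V),
        (Φ V (NCForms.DR.dd (NCForms.PathAlgebra.vertexAlgebra k V) a b) :
            NCForms.PathAlgebra k V) =
          ∑ i : V, NCForms.PathAlgebra.e k i * (a * b - b * a) * NCForms.PathAlgebra.e k i) ∧
      (∀ (V W : Type u) [Fintype V] [Quiver.{v} V] [Fintype W] [Quiver.{v} W]
        (f : NCForms.PathAlgebra k V →ₐ[k] NCForms.PathAlgebra k W)
        (hf : (NCForms.PathAlgebra.vertexAlgebra k V).map f =
          NCForms.PathAlgebra.vertexAlgebra k W)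
        (x : NCForms.DR.closed (NCForms.PathAlgebra.vertexAlgebra k V) 2),
        (Φ W (NCForms.DR.closedMap _ _ f hf.le 2 x) : NCForms.PathAlgebra k W) =
          f (Φ V x : NCForms.PathAlgebra k V)) :=
  ⟨fun V _ _ => NCForms.PathAlgebra.closedEquiv k V,
    fun V _ _ a b => by
      rw [NCForms.PathAlgebra.closedEquiv_dd, NCForms.PathAlgebra.diag_apply],
    fun V W _ _ _ _ f hf x => NCForms.PathAlgebra.closedEquiv_closedMap f hf x⟩
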